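/- Let $G$ be a connected real semisimple Lie group with trivial center, realized as a closed subgroup of $GL(V)$ for a finite-dimensional real vector space $V$, and let $h\in G$ be such that $\sigma(g)=hgh^{-1}$ satisfies $\sigma^2=\mathrm{id}$ (so that $h^2=e$). Let $\hat K=\{g\in G:\sigma(g)=g\}$ and let $\mathfrak g=\mathfrak k\oplus\mathfrak p$ be the decomposition of the Lie algebra into the $(\pm1)$-eigenspaces of $X\mapsto hXh^{-1}$. Equip $G$ with the bi-invariant pseudo-Riemannian metric given by a non-degenerate symmetric $\mathrm{Ad}(G)$-invariant bilinear form on $\mathfrak g$, and $G/\hat K$ with the $G$-invariant metric given by its restriction to $\mathfrak p$. A smooth map from a Riemann surface into $G$ or $G/\hat K$ is harmonic if it is a critical point of the energy under compactly supported smooth variations. Let $\mathfrak C_h:G/\hat K\to G$, $\mathfrak C_h(g\hat K)=ghg^{-1}$, be the modified Cartan embedding, and let $G_h=\{ghg^{-1}:g\in G\}$. Let $M$ be a connected Riemann surface and $z_0\in M$. Then: 1. $\mathfrak C_h$ is a bijection of $G/\hat K$ onto $G_h$. 2. The map $\mathcal F\mapsto\mathfrak C_h\circ\mathcal F$ is a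 bijection from the set of harmonic maps $\mathcal F:M\to G/\hat K$ with $\mathcal F(z_0)=e\hat K$ onto the set of modified harmonic maps $M\to G_h$ (with base point $z_0$), that is, of the harmonic maps $\mathbb F:M\to G$ with values in $G_h$ such that $\mathbb F(z)^2=e$ for all $z\in M$ and $\mathbb F(z_0)=h$. (Its inverse is $\mathbb F\mapsto\mathfrak C_h^{-1}\circ\mathbb F$.) 3. This is compatible with associated families: let $p:\tilde M\to M$ be the (holomorphic) universal covering, $\tilde z_0\in\tilde M$ with $p(\tilde z_0)=z_0$, let $\mathcal F$ be as in 2, and let $F_\lambda:\tilde M\to G$ $(\lambda\in S^1)$ be an extended frame of $\mathcal F$, i.e. a family of smooth maps with $F_\lambda(\tilde z_0)=e$, $F_1\hat K=\mathcal F\circ p$ and $F_\lambda^{-1}dF_\lambda=\lambda^{-1}\alpha_{\mathfrak p}'+\alpha_{\mathfrak k}+\lambda\alpha_{\mathfrak p}''$, where $\alpha=F_1^{-1}dF_1=\alpha_{\mathfrak k}+\alpha_{\mathfrak p}$ and $\alpha_{\mathfrak p}',\alpha_{\mathfrak p}''$ are the $(1,0)$- and $(0,1)$-parts of $\alpha_{\mathfrak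 p}$. Then for every $\lambda\in S^1$ the map $\mathcal F_\lambda=F_\lambda\hat K:\tilde M\to G/\hat K$ is harmonic with $\mathcal F_\lambda(\tilde z_0)=e\hat K$, and $\mathfrak C_h\circ\mathcal F_\lambda=F_\lambda hF_\lambda^{-1}$ is a modified harmonic map $\tilde M\to G_h$ with base point $\tilde z_0$. -/

import Mathlib

open Set MeasureTheory
open scoped Manifold ContDiff TensorProduct

/- The commutator bracket of an associative ring. -/
attribute [local instance] LieRing.ofAssociativeRing

noncomputable section

namespace CartanHarmonic

/- `A` is the algebra `End V` of endomorphisms (matrices) of a finite-dimensional real vector space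
`V`, with any submultiplicative norm, so that `Aˣ = GL(V)`; only its structure of an algebra is
used. `G` is a subgroup of `Aˣ`. -/
variable {A : Type*} [NormedRing A] {G : Subgroup Aˣ}

/-- The endomorphism (matrix) underlying an element of the linear group `G`. -/
def mat (g : G) : A := ((g : Aˣ) : A)

@[simp] theorem mat_one : mat (1 : G) = 1 := by simp [mat]

@[simp] theorem mat_mul (a b : G) : mat (a * b) = mat a * mat b := by simp [mat]

@[simp] theorem mat_mul_inv (a : G) : mat a * mat a⁻¹ = 1 := by rw [← mat_mul]; simp

@[simp] theorem mat_inv_mul (a : G) : mat a⁻¹ * mat a = 1 := by rw [← mat_mul]; simp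

theorem mat_inv_eq (a : G) : mat a⁻¹ = Ring.inverse (mat a) := by
  simp [mat]

/-- The fixed point group `K` in `G` of the inner automorphism `g ↦ h g h⁻¹`. -/
def fixGroup (h : G) : Subgroup G :=
  (MulAut.conj h).toMonoidHom.eqLocus (MonoidHom.id G)

theorem mem_fixGroup {h g : G} : g ∈ fixGroup h ↔ h * g * h⁻¹ = g := Iff.rfl

/-- The quotient `G / K`. -/
abbrev SymSpace (h : G) : Type _ := G ⧸ fixGroup h

theorem conj_eq_conj_iff {h a b : G} : a * h * a⁻¹ = b * h * b⁻¹ ↔ a⁻¹ * b ∈ fixGroup h := by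
  rw [mem_fixGroup]
  constructor
  · intro e
    have : h = a⁻¹ * (b * h * b⁻¹) * a := by rw [← e]; group
    calc h * (a⁻¹ * b) * h⁻¹ = a⁻¹ * (b * h * b⁻¹) * a * (a⁻¹ * b) * h⁻¹ := by rw [← this]
      _ = a⁻¹ * b := by group
  · intro e
    have e' : h * (a⁻¹ * b) = a⁻¹ * b * h := by
      calc h * (a⁻¹ * b) = h * (a⁻¹ * b) * h⁻¹ * h := by group
        _ = _ := by rw [e]
    calc a * h * a⁻¹ = a * (h * (a⁻¹ * b)) * b⁻¹ := by group
      _ = a * (a⁻¹ * b * h) * b⁻¹ := by rw [e']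
      _ = b * h * b⁻¹ := by group

/-- The modified Cartan embedding `g K ↦ g h g⁻¹`. -/
def cartanEmbedding (h : G) : SymSpace h → G :=
  Quotient.lift (fun g : G => g * h * g⁻¹) (fun _ _ hab =>
    conj_eq_conj_iff.2 (QuotientGroup.leftRel_apply.1 hab))

/-- The conjugacy class `{g h g⁻¹}` of `h` in `G`. -/
def conjClass (h : G) : Set G := {x | ∃ g : G, x = g * h * g⁻¹}

variable [NormedAlgebra ℝ A]

/-- Smoothness on `U` of a map from a normed space into the matrix group `G`. -/
def SmoothOn {E : Type*} [NormedAddCommGroup E] [NormedSpace ℝ E] (F : E → G) (U : Set E) : Prop :=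
  ContDiffOn ℝ ∞ (fun w => mat (F w)) U

section smooth

variable {E : Type*} [NormedAddCommGroup E] [NormedSpace ℝ E]

theorem SmoothOn.mul {F H : E → G} {U : Set E} (hF : SmoothOn F U) (hH : SmoothOn H U) :
    SmoothOn (fun w => F w * H w) U := by
  unfold SmoothOn at *
  simp only [mat_mul]
  exact hF.mul hH

theorem SmoothOn.inv [CompleteSpace A] {F : E → G} {U : Set E} (hF : SmoothOn F U) :
    SmoothOn (fun w => (F w)⁻¹) U := by
  unfold SmoothOn at *
  simp only [mat_inv_eq]
  intro w hw
  exact (contDiffAt_ringInverse ℝ (F w : Aˣ)).comp_contDiffWithinAt w (hF w hw)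

theorem smoothOn_const (g : G) (U : Set E) : SmoothOn (fun _ : E => g) U :=
  contDiffOn_const

end smooth

/-- `X` is the velocity at the identity of a smooth curve in `G`. -/
def IsVelocity (G : Subgroup Aˣ) (X : A) : Prop :=
  ∃ γ : ℝ → G, SmoothOn γ univ ∧ γ 0 = 1 ∧ HasDerivAt (fun t => mat (γ t)) X 0

theorem IsVelocity.conj {X : A} (hX : IsVelocity G X) (g : G) :
    IsVelocity G (mat g * X * mat g⁻¹) := by
  obtain ⟨γ, h1, h2, h3⟩ := hX
  refine ⟨fun t => g * γ t * g⁻¹, ((smoothOn_const g _).mul h1).mul (smoothOn_const g⁻¹ _), ?_, ?_⟩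
  · simp [h2]
  · simp only [mat_mul]
    exact (h3.const_mul (mat g)).mul_const (mat g⁻¹)

/-- The tangent space of `G` at the identity. -/
def tangentOne (G : Subgroup Aˣ) : Submodule ℝ (A) where
  carrier := {X | IsVelocity G X}
  zero_mem' := ⟨fun _ => 1, smoothOn_const 1 _, rfl, hasDerivAt_const _ _⟩
  add_mem' := by
    rintro X Y ⟨γ, h1, h2, h3⟩ ⟨δ, k1, k2, k3⟩
    refine ⟨fun t => γ t * δ t, h1.mul k1, by simp [h2, k2], ?_⟩
    have := h3.fun_mul k3
    simpa [h2, k2] using this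
  smul_mem' := by
    rintro c X ⟨γ, h1, h2, h3⟩
    refine ⟨fun t => γ (c * t), ?_, by simp [h2], ?_⟩
    · exact ContDiffOn.comp (g := fun t => mat (γ t)) (f := fun t : ℝ => c * t) (t := univ) h1
        (contDiff_const.mul contDiff_id).contDiffOn (fun _ _ => mem_univ _)
    · have hc : HasDerivAt (fun t : ℝ => c * t) c 0 := by
        simpa using (hasDerivAt_id (0 : ℝ)).const_mul c
      have h3' : HasDerivAt (fun t => mat (γ t)) X (c * 0) := by simpa using h3
      exact h3'.scomp (0 : ℝ) hc

variable [FiniteDimensional ℝ A]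

theorem hasDerivAt_mem (S : Submodule ℝ (A)) {f : ℝ → A} {X : A}
    (hf : HasDerivAt f X 0) (hS : ∀ t, f t ∈ S) : X ∈ S := by
  have hcl : IsClosed (S : Set (A)) := S.closed_of_finiteDimensional
  refine hcl.mem_of_tendsto (hasDerivAt_iff_tendsto_slope.1 hf) (Filter.Eventually.of_forall ?_)
  intro t
  simp only [slope_def_module]
  exact S.smul_mem _ (S.sub_mem (hS _) (hS _))

/-- The Lie algebra of the matrix group `G`, with the commutator of matrices as bracket. -/
def lieAlg (G : Subgroup Aˣ) : LieSubalgebra ℝ (A) where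
  toSubmodule := tangentOne G
  lie_mem' := by
    intro X Y hX hY
    have : CompleteSpace A := FiniteDimensional.complete ℝ A
    obtain ⟨γ, h1, h2, h3⟩ := hX
    have hi : HasDerivAt (fun t => mat (γ t)⁻¹) (-X) 0 := by
      have hsm : DifferentiableAt ℝ (fun t => mat (γ t)⁻¹) 0 :=
        ((h1.inv.contDiffAt Filter.univ_mem).differentiableAt (by simp))
      have hp := h3.mul hsm.hasDerivAt
      have hq : HasDerivAt ((fun t => mat (γ t)) * fun t => mat (γ t)⁻¹) 0 0 := by
        have : ((fun t => mat (γ t)) * fun t => mat (γ t)⁻¹) = fun _ => (1 : A) := by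
          funext t; simp
        rw [this]; exact hasDerivAt_const _ _
      have he := hp.unique hq
      simp [h2] at he
      have : deriv (fun t => mat (γ t)⁻¹) 0 = -X := by
        rw [eq_neg_iff_add_eq_zero, add_comm]; exact he
      rw [← this]; exact hsm.hasDerivAt
    have hd : HasDerivAt (fun t => mat (γ t) * Y * mat (γ t)⁻¹) (X * Y - Y * X) 0 := by
      have := (h3.mul_const Y).fun_mul hi
      simpa [h2, sub_eq_add_neg] using this
    have := hasDerivAt_mem (tangentOne G) hd (fun t => IsVelocity.conj hY (γ t))
    simpa [Ring.lie_def] using this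

/-- The adjoint action of `G` on its Lie algebra. -/
def Ad (g : G) (X : lieAlg G) : lieAlg G :=
  ⟨mat g * (X : A) * mat g⁻¹, IsVelocity.conj X.2 g⟩

/-- A bi-invariant pseudo-Riemannian metric on `G`, that is, a non-degenerate symmetric bilinear
form on the Lie algebra which is invariant under the adjoint action (for semisimple `G` for example
plus or minus the Killing form). -/
structure BiinvariantMetric (G : Subgroup Aˣ) where
  form : LinearMap.BilinForm ℝ (lieAlg G)
  symm : form.IsSymm
  nondegenerate : form.Nondegenerate
  invariant : ∀ (g : G) (X Y : lieAlg G), form (Ad g X) (Ad g Y) = form X Y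

open Classical in
/-- The square `⟨X, X⟩` of an element `X` of the Lie algebra of `G`, given as a matrix. -/
def normSq (B : BiinvariantMetric G) (X : A) : ℝ :=
  if hX : X ∈ lieAlg G then B.form ⟨X, hX⟩ ⟨X, hX⟩ else 0

/-- The pulled back Maurer-Cartan form `F⁻¹ dF`, at the point `w`, evaluated on the vector `v`. -/
def maurerCartan {E : Type*} [NormedAddCommGroup E] [NormedSpace ℝ E] (F : E → G) (w v : E) :
    A :=
  mat (F w)⁻¹ * fderiv ℝ (fun x => mat (F x)) w v

/-- The Maurer-Cartan form of a smooth map takes values in the Lie algebra, so that `normSq` never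
meets its default value. -/
theorem maurerCartan_mem {E : Type*} [NormedAddCommGroup E] [NormedSpace ℝ E] {F : E → G}
    {V : Set E} (hV : IsOpen V) (hF : SmoothOn F V) {w : E} (hw : w ∈ V) (v : E) :
    maurerCartan F w v ∈ lieAlg G := by
  have hcont : Continuous (fun s : ℝ => w + s • v) := by fun_prop
  obtain ⟨ε, hε, hb⟩ := Metric.isOpen_iff.1 (hV.preimage hcont) 0 (by simpa using hw)
  set φ : ℝ → ℝ := fun t => (ε / 2) * Real.sin (t / (ε / 2)) with hφ
  have hφs : ContDiff ℝ ∞ φ := by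
    exact contDiff_const.mul (Real.contDiff_sin.comp (contDiff_id.div_const _))
  have hφd : HasDerivAt φ 1 0 := by
    have h1 : HasDerivAt (fun t : ℝ => t / (ε / 2)) (1 / (ε / 2)) 0 :=
      (hasDerivAt_id (0 : ℝ)).div_const _
    have h2 := (h1.sin).const_mul (ε / 2)
    have : ε / 2 * (Real.cos (0 / (ε / 2)) * (1 / (ε / 2))) = 1 := by
      simp [hε.ne']
    rw [this] at h2
    exact h2
  have hφV : ∀ t, w + φ t • v ∈ V := by
    intro t
    apply hb
    simp only [Metric.mem_ball, dist_zero_right, Real.norm_eq_abs, hφ, abs_mul]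
    rw [abs_of_pos (by positivity : 0 < ε / 2)]
    have := Real.abs_sin_le_one (t / (ε / 2))
    nlinarith
  have hc : ContDiff ℝ ∞ (fun t => w + φ t • v) :=
    contDiff_const.add (hφs.smul contDiff_const)
  have hcd : HasDerivAt (fun t => w + φ t • v) v 0 := by
    simpa using (hφd.smul_const v).const_add w
  have hφ0 : φ 0 = 0 := by simp [hφ]
  have hsm : SmoothOn (fun t : ℝ => F (w + φ t • v)) univ :=
    ContDiffOn.comp (g := fun x => mat (F x)) hF hc.contDiffOn (fun t _ => hφV t)
  refine ⟨fun t => (F w)⁻¹ * F (w + φ t • v), (smoothOn_const _ _).mul hsm, by simp [hφ0], ?_⟩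
  simp only [mat_mul]
  have hdF : HasFDerivAt (fun x => mat (F x)) (fderiv ℝ (fun x => mat (F x)) w) (w + φ 0 • v) := by
    have : DifferentiableAt ℝ (fun x => mat (F x)) w :=
      ((hF.contDiffAt (hV.mem_nhds hw)).differentiableAt (by simp))
    simpa [hφ0] using this.hasFDerivAt
  exact (hdF.comp_hasDerivAt (0 : ℝ) hcd).const_mul _

/-! ### The symmetric space `G / K` and its metric -/

/-- The component in `𝔨` of a Lie algebra element `X`, where `𝔤 = 𝔨 ⊕ 𝔭` is the decomposition into
the `1`- and `(-1)`-eigenspaces of the involution `X ↦ h X h⁻¹`. -/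
def kPart (h : G) (X : A) : A := (1 / 2 : ℝ) • (X + mat h * X * mat h⁻¹)

/-- The component in `𝔭` of a Lie algebra element `X`. -/
def pPart (h : G) (X : A) : A := (1 / 2 : ℝ) • (X - mat h * X * mat h⁻¹)

section quotient

variable {E : Type*} [NormedAddCommGroup E] [NormedSpace ℝ E]

/-- `F` is a smooth lift to `G`, over the set `V`, of the map `u` into `G / K`. -/
def IsLift {h : G} (u : E → SymSpace h) (F : E → G) (V : Set E) : Prop :=
  SmoothOn F V ∧ ∀ w ∈ V, u w = (F w : SymSpace h)

/-- Smoothness on the open set `U` of a map into `G / K`: since `G → G / K` is a smooth principal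
bundle, the smooth maps are those that lift locally to smooth maps into `G`. -/
def QuotSmoothOn {h : G} (u : E → SymSpace h) (U : Set E) : Prop :=
  ∀ w ∈ U, ∃ V : Set E, IsOpen V ∧ w ∈ V ∧ ∃ F : E → G, IsLift u F V

end quotient

/-! ### Energy densities and harmonic maps on open subsets of `ℂ` -/

/-- The energy density of a map from an open subset of `ℂ` into `G`. -/
def energyDensity (B : BiinvariantMetric G) (u : ℂ → G) (w : ℂ) : ℝ :=
  (1 / 2) * (normSq B (maurerCartan u w 1) + normSq B (maurerCartan u w Complex.I))

/-- The energy density of `w ↦ F w K`, where `T (G / K)` at `g K` is identified with `𝔭` by the left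
translation with `g`, and `𝔭` carries the restriction of the given form. -/
def liftEnergyDensity (B : BiinvariantMetric G) (h : G) (F : ℂ → G) (w : ℂ) : ℝ :=
  (1 / 2) * (normSq B (pPart h (maurerCartan F w 1)) +
    normSq B (pPart h (maurerCartan F w Complex.I)))

open Classical in
/-- The energy density of a map from an open subset of `ℂ` into `G / K`, for the `G`-invariant
metric induced by the given form; it is computed with any smooth local lift. -/
def quotEnergyDensity (B : BiinvariantMetric G) {h : G} (u : ℂ → SymSpace h) (w : ℂ) : ℝ :=
  if H : ∃ F : ℂ → G, ∃ V : Set ℂ, IsOpen V ∧ w ∈ V ∧ IsLift u F V then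
    liftEnergyDensity B h H.choose w
  else 0

theorem normSq_conj (B : BiinvariantMetric G) (g : G) (X : A) :
    normSq B (mat g * X * mat g⁻¹) = normSq B X := by
  have key : ∀ (a : G) (Y : A), Y ∈ lieAlg G → mat a * Y * mat a⁻¹ ∈ lieAlg G :=
    fun a Y hY => IsVelocity.conj hY a
  by_cases hX : X ∈ lieAlg G
  · have h1 := key g X hX
    simp only [normSq, hX, h1, dif_pos]
    exact B.invariant g ⟨X, hX⟩ ⟨X, hX⟩
  · have h1 : mat g * X * mat g⁻¹ ∉ lieAlg G := by
      intro h1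
      apply hX
      have h2 := key g⁻¹ _ h1
      have : mat g⁻¹ * (mat g * X * mat g⁻¹) * mat g⁻¹⁻¹ = X := by
        calc _ = (mat g⁻¹ * mat g) * X * (mat g⁻¹ * mat g⁻¹⁻¹) := by noncomm_ring
          _ = X := by simp
      rwa [this] at h2
    simp only [normSq, hX, h1, dif_neg, not_false_iff]

/-- The `𝔭`-part of the Maurer-Cartan form in terms of `F h F⁻¹`. -/
theorem pPart_maurerCartan {h : G} {F : ℂ → G} {V : Set ℂ} (hV : IsOpen V) (hF : SmoothOn F V)
    {w : ℂ} (hw : w ∈ V) (v : ℂ) :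
    pPart h (maurerCartan F w v) = (1 / 2 : ℝ) • (mat (F w)⁻¹ *
      fderiv ℝ (fun x => mat (F x * h * (F x)⁻¹)) w v * mat (F w) * mat h⁻¹) := by
  have : CompleteSpace A := FiniteDimensional.complete ℝ A
  have hx : SmoothOn (fun x => F x * h * (F x)⁻¹) V := (hF.mul (smoothOn_const h _)).mul hF.inv
  have dF : DifferentiableAt ℝ (fun x => mat (F x)) w :=
    ((hF.contDiffAt (hV.mem_nhds hw)).differentiableAt (by simp))
  have dx : DifferentiableAt ℝ (fun x => mat (F x * h * (F x)⁻¹)) w :=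
    ((hx.contDiffAt (hV.mem_nhds hw)).differentiableAt (by simp))
  have e1 : (fun x => mat (F x * h * (F x)⁻¹)) * (fun x => mat (F x)) =
      fun x => mat (F x) * mat h := by
    funext x
    simp only [Pi.mul_apply]
    rw [← mat_mul, ← mat_mul]
    congr 1
    group
  have e2 := dx.hasFDerivAt.mul' dF.hasFDerivAt
  rw [e1] at e2
  have e3 := congrArg (fun L => L v) (e2.unique (dF.hasFDerivAt.mul_const' (mat h)))
  have e3' : mat (F w * h * (F w)⁻¹) * (fderiv ℝ (fun x => mat (F x)) w) v +
      (fderiv ℝ (fun x => mat (F x * h * (F x)⁻¹)) w) v * mat (F w) =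
      (fderiv ℝ (fun x => mat (F x)) w) v * mat h := e3
  simp only [mat_mul] at e3'
  simp only [pPart, maurerCartan]
  congr 1
  set D := (fderiv ℝ (fun x => mat (F x)) w) v
  set Dx := (fderiv ℝ (fun x => mat (F x) * mat h * mat (F x)⁻¹) w) v with hDx
  have hDx' : (fderiv ℝ (fun x => mat (F x * h * (F x)⁻¹)) w) v = Dx := by
    simp [hDx]
  rw [hDx']
  have e4 : Dx * mat (F w) = D * mat h - mat (F w) * mat h * mat (F w)⁻¹ * D := by
    rw [← e3']; noncomm_ring
  have e5 : mat (F w)⁻¹ * Dx * mat (F w) * mat h⁻¹ = mat (F w)⁻¹ * (Dx * mat (F w)) * mat h⁻¹ := by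
    noncomm_ring
  rw [e5, e4]
  have e6 : mat (F w)⁻¹ * (D * mat h - mat (F w) * mat h * mat (F w)⁻¹ * D) * mat h⁻¹ =
      mat (F w)⁻¹ * D * (mat h * mat h⁻¹) -
        (mat (F w)⁻¹ * mat (F w)) * (mat h * (mat (F w)⁻¹ * D) * mat h⁻¹) := by noncomm_ring
  rw [e6]
  simp

/-- The energy density of a map into `G / K` does not depend on the lift. -/
theorem quotEnergyDensity_eq (B : BiinvariantMetric G) {h : G} {u : ℂ → SymSpace h} {F : ℂ → G}
    {V : Set ℂ} (hV : IsOpen V) (hF : IsLift u F V) {w : ℂ} (hw : w ∈ V) :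
    quotEnergyDensity B u w = liftEnergyDensity B h F w := by
  have H : ∃ F : ℂ → G, ∃ V : Set ℂ, IsOpen V ∧ w ∈ V ∧ IsLift u F V := ⟨F, V, hV, hw, hF⟩
  obtain ⟨V', hV', hw', hF'⟩ := H.choose_spec
  simp only [quotEnergyDensity, dif_pos H]
  set F' := H.choose
  have hk : ∀ x ∈ V ∩ V', (F x)⁻¹ * F' x ∈ fixGroup h := by
    intro x hx
    have := (hF.2 x hx.1).symm.trans (hF'.2 x hx.2)
    exact QuotientGroup.eq.1 this
  have hD : fderiv ℝ (fun x => mat (F' x * h * (F' x)⁻¹)) w =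
      fderiv ℝ (fun x => mat (F x * h * (F x)⁻¹)) w := by
    apply Filter.EventuallyEq.fderiv_eq
    filter_upwards [(hV.inter hV').mem_nhds ⟨hw, hw'⟩] with x hx
    rw [conj_eq_conj_iff.2 (hk x hx)]
  have main : ∀ v : ℂ, normSq B (pPart h (maurerCartan F' w v)) =
      normSq B (pPart h (maurerCartan F w v)) := by
    intro v
    rw [← normSq_conj B ((F w)⁻¹ * F' w)]
    congr 1
    rw [pPart_maurerCartan hV' hF'.1 hw', pPart_maurerCartan hV hF.1 hw, hD]
    set D := (fderiv ℝ (fun x => mat (F x * h * (F x)⁻¹)) w) v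
    have hkk : h⁻¹ * ((F w)⁻¹ * F' w)⁻¹ = ((F w)⁻¹ * F' w)⁻¹ * h⁻¹ := by
      have := mem_fixGroup.1 (hk w ⟨hw, hw'⟩)
      rw [← mul_inv_rev, ← mul_inv_rev]
      congr 1
      calc (F w)⁻¹ * F' w * h = h * ((F w)⁻¹ * F' w) * h⁻¹ * h := by rw [this]
        _ = _ := by group
    rw [mul_smul_comm, smul_mul_assoc]
    congr 1
    calc mat ((F w)⁻¹ * F' w) * (mat (F' w)⁻¹ * D * mat (F' w) * mat h⁻¹) *
          mat ((F w)⁻¹ * F' w)⁻¹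
        = mat ((F w)⁻¹ * F' w) * mat (F' w)⁻¹ * D * (mat (F' w) *
            (mat h⁻¹ * mat ((F w)⁻¹ * F' w)⁻¹)) := by noncomm_ring
      _ = mat ((F w)⁻¹ * F' w) * mat (F' w)⁻¹ * D * (mat (F' w) *
            (mat ((F w)⁻¹ * F' w)⁻¹ * mat h⁻¹)) := by
          rw [← mat_mul h⁻¹, hkk, mat_mul _ h⁻¹]
      _ = mat ((F w)⁻¹ * F' w * (F' w)⁻¹) * D * mat (F' w * ((F w)⁻¹ * F' w)⁻¹ ) * mat h⁻¹ := by
          simp only [mat_mul]; noncomm_ring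
      _ = _ := by
          congr 3
          · congr 2; group
          · group
  simp only [liftEnergyDensity, main]

/-- A map `u` from the open set `U ⊆ ℂ` into `G` is harmonic: it is smooth and a critical point of
the energy with respect to all smooth variations with compact support. -/
structure HarmonicOn (B : BiinvariantMetric G) (u : ℂ → G) (U : Set ℂ) : Prop where
  smooth : SmoothOn u U
  critical : ∀ Φ : ℝ → ℂ → G, SmoothOn (fun p : ℝ × ℂ => Φ p.1 p.2) (univ ×ˢ U) →
    (∀ w ∈ U, Φ 0 w = u w) →
    ∀ C : Set ℂ, IsCompact C → C ⊆ U → (∀ t, ∀ w ∈ U \ C, Φ t w = u w) →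
    HasDerivAt (fun t => ∫ w in C, energyDensity B (Φ t) w) 0 0

/-- A map `u` from the open set `U ⊆ ℂ` into `G / K` is harmonic: it is smooth and a critical point
of the energy with respect to all smooth variations with compact support. -/
structure QuotHarmonicOn (B : BiinvariantMetric G) {h : G} (u : ℂ → SymSpace h) (U : Set ℂ) :
    Prop where
  smooth : QuotSmoothOn u U
  critical : ∀ Φ : ℝ → ℂ → SymSpace h,
    QuotSmoothOn (fun p : ℝ × ℂ => Φ p.1 p.2) (univ ×ˢ U) →
    (∀ w ∈ U, Φ 0 w = u w) →
    ∀ C : Set ℂ, IsCompact C → C ⊆ U → (∀ t, ∀ w ∈ U \ C, Φ t w = u w) →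
    HasDerivAt (fun t => ∫ w in C, quotEnergyDensity B (Φ t) w) 0 0

/-! ### Harmonic maps on Riemann surfaces -/

section surface

variable {M : Type*} [TopologicalSpace M] [ChartedSpace ℂ M]

/-- Harmonic maps from a Riemann surface into `G`. Harmonicity is a local property, and in dimension
two the energy is conformally invariant, so that it can be tested in the holomorphic charts. -/
def IsHarmonic (B : BiinvariantMetric G) (f : M → G) : Prop :=
  ∀ e ∈ atlas ℂ M, HarmonicOn B (fun w => f (e.symm w)) e.target

/-- Harmonic maps from a Riemann surface into `G / K`. -/
def IsQuotHarmonic (B : BiinvariantMetric G) {h : G} (f : M → SymSpace h) : Prop :=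
  ∀ e ∈ atlas ℂ M, QuotHarmonicOn B (fun w => f (e.symm w)) e.target

/-- The harmonic maps into `G / K` that send the base point `z₀` to `e K`. -/
def BasedHarmonic (B : BiinvariantMetric G) (h : G) (z₀ : M) : Set (M → SymSpace h) :=
  {f | IsQuotHarmonic B f ∧ f z₀ = ((1 : G) : SymSpace h)}

/-- The modified harmonic maps: the harmonic maps into `G` with values in the conjugacy class of
`h`, with square `e`, and with value `h` at `z₀`. -/
def ModifiedHarmonic (B : BiinvariantMetric G) (h : G) (z₀ : M) : Set (M → G) :=
  {f | IsHarmonic B f ∧ (∀ z, f z ∈ conjClass h) ∧ (∀ z, f z * f z = 1) ∧ f z₀ = h}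

/-- An element of `A` as an element of the complexification `ℂ ⊗ A`. -/
def complexify (X : A) : ℂ ⊗[ℝ] A := (1 : ℂ) ⊗ₜ[ℝ] X

/-- The `(1,0)`-part (complex linear part) of a real linear form on `ℂ` with values in `A`. -/
def part10 (α : ℂ → A) (v : ℂ) : ℂ ⊗[ℝ] A :=
  (1 / 2 : ℂ) • (complexify (α v) - Complex.I • complexify (α (Complex.I * v)))

/-- The `(0,1)`-part (complex antilinear part). -/
def part01 (α : ℂ → A) (v : ℂ) : ℂ ⊗[ℝ] A :=
  (1 / 2 : ℂ) • (complexify (α v) + Complex.I • complexify (α (Complex.I * v)))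

/-- `F` is an extended frame, normalized at `z₀`, of the map `f` into `G / K`: a family of smooth
maps `F_λ` into `G`, `|λ| = 1`, such that `F_1` is a lift of `f`, `F_λ(z₀) = e`, and
`F_λ⁻¹ dF_λ = λ⁻¹ α_𝔭' + α_𝔨 + λ α_𝔭''` in every holomorphic chart, where `α = F_1⁻¹ dF_1`. -/
structure IsExtendedFrame (h : G) (z₀ : M) (f : M → SymSpace h) (F : Circle → M → G) : Prop where
  smooth : ∀ l : Circle, ∀ e ∈ atlas ℂ M, SmoothOn (fun w => F l (e.symm w)) e.target
  lift : ∀ z, f z = (F 1 z : SymSpace h)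
  base : ∀ l : Circle, F l z₀ = 1
  equation : ∀ l : Circle, ∀ e ∈ atlas ℂ M, ∀ w ∈ e.target, ∀ v : ℂ,
    complexify (maurerCartan (fun x => F l (e.symm x)) w v) =
      (l : ℂ)⁻¹ • part10 (fun v' => pPart h (maurerCartan (fun x => F 1 (e.symm x)) w v')) v
      + complexify (kPart h (maurerCartan (fun x => F 1 (e.symm x)) w v))
      + (l : ℂ) • part01 (fun v' => pPart h (maurerCartan (fun x => F 1 (e.symm x)) w v')) v

end surface

end CartanHarmonic

end

noncomputable section

namespace CartanHarmonic

variable {A : Type*} [NormedRing A] {G : Subgroup Aˣ}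

/-! Injectivity of the modified Cartan embedding is the fact that `g h g⁻¹` determines `g` up to the
centralizer of `h`, which is the fixed group of `σ`. Since `σ²` is conjugation by `h²`, a trivial
center forces `h² = e`, and everything else rests on this.

Harmonicity in `G` is governed by the tension `τ(u) = div (u⁻¹ du)`: by the Maurer-Cartan equation
and the invariance of the form, the first variation of the energy is `-∫ ⟨η, τ⟩` for the variation
field `η` (`hasDerivAt_energy`). The Cartan embedding multiplies the energy density by 4
(`quotEnergyDensity_eq_energyDensity`), and a variation in `G / K` composes to one in `G`. So `u` is
harmonic as soon as its image `c` is. The converse says that the image is totally geodesic. From `c²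
= e` it follows that `Ad(c) τ = -τ` (`conj_tension_of_mul_self`), while the variations `γ(tφ) u`,
which do come from `G / K`, give `⟨Ad(c⁻¹) X - X, τ⟩ = 0` for every `X` in the Lie algebra. Together
these read `-2 ⟨X, τ⟩ = 0`, and non-degeneracy yields `τ = 0` (`tension_eq_zero_of_quotHarmonicOn`).

Surjectivity in the second claim also needs smoothness of the map into `G / K`, that is, smooth
local lifts. Near a point write `f = g₀ a h g₀⁻¹` with `a` close to `e` and inverted by `σ`; then `k
= exp (½ log a)` satisfies `k h k⁻¹ = k² h = a h`. That `k` lies in `G` is the closed subgroup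
theorem (`eventually_mem_range_exp`, `exp_mem_of_mem_lieAlg`).

For the associated family, `τ(F h F⁻¹) = -2 Ad(F) D(F)`, where `D` is the divergence of `α_𝔭`
covariant with respect to `α_𝔨` (`tension_conj`). Passing from `F_1` to `F_λ` multiplies `D` by `Re
λ`, because the coefficient of `Im λ` is the `𝔭`-part of the Maurer-Cartan equation
(`covariantDivergence_frame`). Vanishing of `τ` passes to the covering by conformal invariance
(`tension_comp`). -/

theorem mat_injective : Function.Injective (mat : G → A) := fun _ _ hab =>
  Subtype.ext (Units.ext hab)

@[simp] theorem mat_mul_inv_cancel_left (a : G) (X : A) : mat a * (mat a⁻¹ * X) = X := by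
  rw [← mul_assoc]; simp

@[simp] theorem mat_inv_mul_cancel_left (a : G) (X : A) : mat a⁻¹ * (mat a * X) = X := by
  rw [← mul_assoc]; simp

@[simp] theorem cartanEmbedding_mk (h g : G) :
    cartanEmbedding h (g : SymSpace h) = g * h * g⁻¹ := rfl

theorem cartanEmbedding_injective (h : G) : Function.Injective (cartanEmbedding h) := by
  intro x y
  induction x using QuotientGroup.induction_on with | H a => ?_
  induction y using QuotientGroup.induction_on with | H b => ?_
  intro hab
  exact QuotientGroup.eq.2 (conj_eq_conj_iff.1 hab)

variable [NormedAlgebra ℝ A] {E : Type*} [NormedAddCommGroup E] [NormedSpace ℝ E]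

/-! ### Calculus of the Maurer-Cartan form. -/

theorem SmoothOn.contDiffAt {F : E → G} {V : Set E} (hV : IsOpen V) (hF : SmoothOn F V) {w : E}
    (hw : w ∈ V) : ContDiffAt ℝ ∞ (fun x => mat (F x)) w :=
  ContDiffOn.contDiffAt hF (hV.mem_nhds hw)

theorem SmoothOn.differentiableAt {F : E → G} {V : Set E} (hV : IsOpen V) (hF : SmoothOn F V)
    {w : E} (hw : w ∈ V) : DifferentiableAt ℝ (fun x => mat (F x)) w :=
  (hF.contDiffAt hV hw).differentiableAt (by simp)

theorem SmoothOn.mono {F : E → G} {V W : Set E} (hF : SmoothOn F V) (h : W ⊆ V) : SmoothOn F W :=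
  ContDiffOn.mono hF h

theorem SmoothOn.congr {F H : E → G} {V : Set E} (hF : SmoothOn F V) (h : ∀ x ∈ V, H x = F x) :
    SmoothOn H V :=
  ContDiffOn.congr hF fun x hx => by rw [h x hx]

theorem SmoothOn.comp {E' : Type*} [NormedAddCommGroup E'] [NormedSpace ℝ E'] {F : E → G}
    {V : Set E} {f : E' → E} {W : Set E'} (hF : SmoothOn F V) (hf : ContDiffOn ℝ ∞ f W)
    (h : MapsTo f W V) : SmoothOn (fun x => F (f x)) W :=
  ContDiffOn.comp (g := fun x => mat (F x)) hF hf h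

theorem maurerCartan_congr {F H : E → G} {V : Set E} (hV : IsOpen V) (h : ∀ x ∈ V, F x = H x)
    {w : E} (hw : w ∈ V) (v : E) : maurerCartan F w v = maurerCartan H w v := by
  have : (fun x => mat (F x)) =ᶠ[nhds w] fun x => mat (H x) := by
    filter_upwards [hV.mem_nhds hw] with x hx
    rw [h x hx]
  simp only [maurerCartan, this.fderiv_eq, h w hw]

/-- The divergence of the pulled back Maurer-Cartan form. -/
def tension (u : ℂ → G) (w : ℂ) : A :=
  fderiv ℝ (fun x => maurerCartan u x 1) w 1 +
    fderiv ℝ (fun x => maurerCartan u x Complex.I) w Complex.I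

theorem tension_congr {u v : ℂ → G} {U : Set ℂ} (hU : IsOpen U) (h : ∀ x ∈ U, u x = v x) {w : ℂ}
    (hw : w ∈ U) : tension u w = tension v w := by
  have key : ∀ a : ℂ, (fun x => maurerCartan u x a) =ᶠ[nhds w] fun x => maurerCartan v x a := by
    intro a
    filter_upwards [hU.mem_nhds hw] with x hx using maurerCartan_congr hU h hx a
  simp only [tension, (key _).fderiv_eq]

variable [FiniteDimensional ℝ A]

theorem hasFDerivAt_mat_inv {F : E → G} {w : E} {D : E →L[ℝ] A}
    (hF : HasFDerivAt (fun x => mat (F x)) D w) :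
    HasFDerivAt (fun x => mat (F x)⁻¹)
      ((-ContinuousLinearMap.mulLeftRight ℝ A (mat (F w)⁻¹) (mat (F w)⁻¹)).comp D) w := by
  have : CompleteSpace A := FiniteDimensional.complete ℝ A
  have h := (hasFDerivAt_ringInverse (𝕜 := ℝ) ((F w : G) : Aˣ)).comp w (f := fun x => mat (F x)) hF
  have e : (fun x => mat (F x)⁻¹) = Ring.inverse ∘ fun x => mat (F x) :=
    funext fun x => mat_inv_eq (F x)
  rw [e]
  exact h

theorem hasDerivAt_mat_inv {F : ℝ → G} {t : ℝ} {X : A} (hF : HasDerivAt (fun x => mat (F x)) X t) :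
    HasDerivAt (fun x => mat (F x)⁻¹) (-(mat (F t)⁻¹ * X * mat (F t)⁻¹)) t := by
  simpa using (hasFDerivAt_mat_inv hF.hasFDerivAt).hasDerivAt

theorem contDiffOn_maurerCartan {F : E → G} {V : Set E} (hV : IsOpen V) (hF : SmoothOn F V)
    (a : E) : ContDiffOn ℝ ∞ (fun x => maurerCartan F x a) V := by
  have : CompleteSpace A := FiniteDimensional.complete ℝ A
  have h1 : ContDiffOn ℝ ∞ (fun x => mat (F x)⁻¹) V := hF.inv
  have h2 : ContDiffOn ℝ ∞ (fderiv ℝ (fun x => mat (F x))) V :=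
    ContDiffOn.fderiv_of_isOpen hF hV (by simp)
  exact h1.mul (h2.clm_apply contDiffOn_const)

/-- The second derivative term is symmetric in `a` and `b`, so only the product term survives
antisymmetrization in `maurerCartan_curl`. -/
theorem fderiv_maurerCartan {F : E → G} {V : Set E} (hV : IsOpen V) (hF : SmoothOn F V) {w : E}
    (hw : w ∈ V) (a b : E) :
    fderiv ℝ (fun x => maurerCartan F x a) w b =
      mat (F w)⁻¹ * fderiv ℝ (fderiv ℝ (fun x => mat (F x))) w b a -
        maurerCartan F w b * maurerCartan F w a := by
  have h1 := hasFDerivAt_mat_inv (hF.differentiableAt hV hw).hasFDerivAt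
  have h2 : DifferentiableAt ℝ (fderiv ℝ (fun x => mat (F x))) w :=
    ((ContDiffOn.fderiv_of_isOpen hF hV (m := ∞) (by simp)).contDiffAt
      (hV.mem_nhds hw)).differentiableAt (by simp)
  have h3 := h1.mul' (h2.hasFDerivAt.clm_apply (hasFDerivAt_const a w))
  have h4 : fderiv ℝ (fun x => maurerCartan F x a) w = _ := h3.fderiv
  rw [h4]
  simp [maurerCartan, sub_eq_add_neg, mul_assoc]

/-- The Maurer-Cartan equation. -/
theorem maurerCartan_curl {F : E → G} {V : Set E} (hV : IsOpen V) (hF : SmoothOn F V) {w : E}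
    (hw : w ∈ V) (a b : E) :
    fderiv ℝ (fun x => maurerCartan F x a) w b - fderiv ℝ (fun x => maurerCartan F x b) w a =
      maurerCartan F w a * maurerCartan F w b - maurerCartan F w b * maurerCartan F w a := by
  have hs : IsSymmSndFDerivAt ℝ (fun x => mat (F x)) w :=
    (hF.contDiffAt hV hw).isSymmSndFDerivAt
      (by simpa using WithTop.coe_le_coe.2 (le_top (a := (2 : ℕ∞))))
  rw [fderiv_maurerCartan hV hF hw, fderiv_maurerCartan hV hF hw, hs.eq a b]
  abel

/-- Difference quotients stay in `S`, which is closed by finite dimension. This keeps the tension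
inside the Lie algebra, where the form is defined. -/
theorem mem_of_hasFDerivAt (S : Submodule ℝ A) {f : E → A} {D : E →L[ℝ] A} {V : Set E}
    (hV : IsOpen V) {w : E} (hw : w ∈ V) (hf : HasFDerivAt f D w) (hS : ∀ x ∈ V, f x ∈ S) (v : E) :
    D v ∈ S := by
  have hcl : IsClosed (S : Set A) := S.closed_of_finiteDimensional
  have h0 : HasDerivAt (fun t : ℝ => w + t • v) v 0 := by
    simpa using ((hasDerivAt_id (0 : ℝ)).smul_const v).const_add w
  have h1 : HasDerivAt (fun t : ℝ => f (w + t • v)) (D v) 0 := by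
    refine HasFDerivAt.comp_hasDerivAt (l := f) (0 : ℝ) ?_ h0
    simpa using hf
  have h2 : ∀ᶠ t : ℝ in nhds 0, w + t • v ∈ V := by
    have := h0.continuousAt.preimage_mem_nhds (t := V) (by simpa using hV.mem_nhds hw)
    exact this
  refine hcl.mem_of_tendsto (hasDerivAt_iff_tendsto_slope.1 h1) ?_
  filter_upwards [h2.filter_mono nhdsWithin_le_nhds] with t ht
  simp only [slope_def_module]
  exact S.smul_mem _ (S.sub_mem (hS _ ht) (hS _ (by simpa using hw)))

/-! ### The bilinear form as a form on the whole matrix algebra -/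

/-- The metric lives on the Lie algebra only, whereas all derivatives are taken in `A`. Composing
with an arbitrary linear projection gives a continuous bilinear form on `A`; the choice of
complement is harmless because the form is evaluated on Lie algebra elements. -/
theorem exists_lieProj (G : Subgroup Aˣ) :
    ∃ π : A →ₗ[ℝ] lieAlg G, π ∘ₗ (lieAlg G).toSubmodule.subtype = LinearMap.id :=
  LinearMap.exists_leftInverse_of_injective _ (Submodule.ker_subtype _)

/-- A linear projection of the matrix algebra onto the Lie algebra of `G`. -/
def lieProj (G : Subgroup Aˣ) : A →ₗ[ℝ] lieAlg G := (exists_lieProj G).choose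

theorem lieProj_of_mem {X : A} (hX : X ∈ lieAlg G) : lieProj G X = ⟨X, hX⟩ :=
  LinearMap.congr_fun (exists_lieProj G).choose_spec (⟨X, hX⟩ : lieAlg G)

/-- An extension of the form of a bi-invariant metric to the matrix algebra. -/
def extForm (B : BiinvariantMetric G) : A →L[ℝ] A →L[ℝ] ℝ :=
  (B.form.compl₁₂ (lieProj G) (lieProj G)).toContinuousBilinearMap

variable (B : BiinvariantMetric G)

theorem extForm_of_mem {X Y : A} (hX : X ∈ lieAlg G) (hY : Y ∈ lieAlg G) :
    extForm B X Y = B.form ⟨X, hX⟩ ⟨Y, hY⟩ := by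
  simp [extForm, lieProj_of_mem hX, lieProj_of_mem hY]

theorem extForm_comm (X Y : A) : extForm B X Y = extForm B Y X := by
  simpa [extForm] using B.symm.eq (lieProj G X) (lieProj G Y)

theorem normSq_eq_extForm {X : A} (hX : X ∈ lieAlg G) : normSq B X = extForm B X X := by
  rw [extForm_of_mem B hX hX, normSq, dif_pos hX]

theorem conj_mem_lieAlg (g : G) {X : A} (hX : X ∈ lieAlg G) : mat g * X * mat g⁻¹ ∈ lieAlg G :=
  IsVelocity.conj hX g

theorem extForm_conj (g : G) {X Y : A} (hX : X ∈ lieAlg G) (hY : Y ∈ lieAlg G) :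
    extForm B (mat g * X * mat g⁻¹) (mat g * Y * mat g⁻¹) = extForm B X Y := by
  rw [extForm_of_mem B hX hY,
    extForm_of_mem B (conj_mem_lieAlg g hX) (conj_mem_lieAlg g hY)]
  exact B.invariant g ⟨X, hX⟩ ⟨Y, hY⟩

theorem eq_zero_of_extForm {Y : A} (hY : Y ∈ lieAlg G)
    (h : ∀ X ∈ lieAlg G, extForm B X Y = 0) : Y = 0 := by
  have := B.nondegenerate.2 ⟨Y, hY⟩ fun X => by
    rw [← h X X.2, extForm_of_mem B X.2 hY]
  exact congrArg Subtype.val this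

theorem hasDerivAt_conj {γ : ℝ → G} {X : A} (h0 : γ 0 = 1)
    (h : HasDerivAt (fun t => mat (γ t)) X 0) (Y : A) :
    HasDerivAt (fun t => mat (γ t) * Y * mat (γ t)⁻¹) (X * Y - Y * X) 0 := by
  have := (h.mul_const Y).fun_mul (hasDerivAt_mat_inv h)
  simpa [h0, sub_eq_add_neg] using this

/-- Differentiating `⟨Ad(γ) X, Ad(γ) Z⟩ = ⟨X, Z⟩` along a curve `γ` with velocity `Z` gives `⟨[Z,
X], Z⟩ + ⟨X, [Z, Z]⟩ = 0`. This removes the bracket term from the first variation. -/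
theorem extForm_commutator {X Z : A} (hX : X ∈ lieAlg G) (hZ : Z ∈ lieAlg G) :
    extForm B (Z * X - X * Z) Z = 0 := by
  obtain ⟨γ, -, h0, h⟩ := id hZ
  have hd : HasDerivAt (fun t => extForm B (mat (γ t) * X * mat (γ t)⁻¹)
      (mat (γ t) * Z * mat (γ t)⁻¹)) _ 0 :=
    (((extForm B).hasFDerivAt.comp_hasDerivAt (0 : ℝ) (hasDerivAt_conj h0 h X)).clm_apply
      (hasDerivAt_conj h0 h Z))
  have hc : (fun t => extForm B (mat (γ t) * X * mat (γ t)⁻¹) (mat (γ t) * Z * mat (γ t)⁻¹)) =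
      fun _ => extForm B X Z := funext fun t => extForm_conj B (γ t) hX hZ
  rw [hc] at hd
  simpa [h0] using hd.unique (hasDerivAt_const _ _)

/-! ### The tension field and the energy of `F h F⁻¹` -/

theorem differentiableAt_maurerCartan {F : E → G} {V : Set E} (hV : IsOpen V) (hF : SmoothOn F V)
    {w : E} (hw : w ∈ V) (a : E) : DifferentiableAt ℝ (fun x => maurerCartan F x a) w :=
  ((contDiffOn_maurerCartan hV hF a).contDiffAt (hV.mem_nhds hw)).differentiableAt (by simp)

theorem tension_mem {u : ℂ → G} {U : Set ℂ} (hU : IsOpen U) (hu : SmoothOn u U) {w : ℂ}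
    (hw : w ∈ U) : tension u w ∈ lieAlg G :=
  (lieAlg G).add_mem
    (mem_of_hasFDerivAt (lieAlg G).toSubmodule hU hw
      (differentiableAt_maurerCartan hU hu hw 1).hasFDerivAt
      (fun _ hx => maurerCartan_mem hU hu hx 1) 1)
    (mem_of_hasFDerivAt (lieAlg G).toSubmodule hU hw
      (differentiableAt_maurerCartan hU hu hw Complex.I).hasFDerivAt
      (fun _ hx => maurerCartan_mem hU hu hx Complex.I) Complex.I)

theorem contDiffOn_tension {u : ℂ → G} {U : Set ℂ} (hU : IsOpen U) (hu : SmoothOn u U) :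
    ContDiffOn ℝ ∞ (tension u) U := by
  have key : ∀ a : ℂ, ContDiffOn ℝ ∞ (fun w => fderiv ℝ (fun x => maurerCartan u x a) w a) U :=
    fun a => ((contDiffOn_maurerCartan hU hu a).fderiv_of_isOpen hU (by simp)).clm_apply
      contDiffOn_const
  exact (key 1).add (key Complex.I)

theorem normSq_smul {X : A} (hX : X ∈ lieAlg G) (c : ℝ) : normSq B (c • X) = c ^ 2 * normSq B X := by
  rw [normSq_eq_extForm B hX, normSq_eq_extForm B ((lieAlg G).smul_mem c hX)]
  simp
  ring

theorem SmoothOn.conj {F : E → G} {V : Set E} (hF : SmoothOn F V) (h : G) :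
    SmoothOn (fun x => F x * h * (F x)⁻¹) V := by
  have : CompleteSpace A := FiniteDimensional.complete ℝ A
  exact (hF.mul (smoothOn_const h _)).mul hF.inv

/-- With `x = F h F⁻¹`, `pPart_maurerCartan` amounts to `α_𝔭 = ½ Ad(h F⁻¹)(x⁻¹ dx)`, and the form is
`Ad`-invariant. -/
theorem normSq_pPart_maurerCartan {h : G} {F : ℂ → G} {V : Set ℂ} (hV : IsOpen V)
    (hF : SmoothOn F V) {w : ℂ} (hw : w ∈ V) (v : ℂ) :
    normSq B (pPart h (maurerCartan F w v)) =
      1 / 4 * normSq B (maurerCartan (fun x => F x * h * (F x)⁻¹) w v) := by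
  have hm := maurerCartan_mem hV (hF.conj h) hw v
  rw [pPart_maurerCartan hV hF hw, ← normSq_conj B (h * (F w)⁻¹) (maurerCartan _ w v),
    normSq_smul]
  · rw [show ((1 / 2 : ℝ) ^ 2 = 1 / 4) by norm_num]
    congr 2
    simp only [maurerCartan, mul_inv_rev, inv_inv, mat_mul, mul_assoc, mat_inv_mul_cancel_left,
      mat_mul_inv_cancel_left]
  · have := conj_mem_lieAlg (h * (F w)⁻¹) hm
    simpa only [maurerCartan, mul_inv_rev, inv_inv, mat_mul, mul_assoc, mat_inv_mul_cancel_left,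
      mat_mul_inv_cancel_left] using this

theorem quotEnergyDensity_eq_energyDensity {h : G} {u : ℂ → SymSpace h} {U : Set ℂ}
    (hu : QuotSmoothOn u U) {w : ℂ} (hw : w ∈ U) :
    quotEnergyDensity B u w = 1 / 4 * energyDensity B (fun x => cartanEmbedding h (u x)) w := by
  obtain ⟨V, hV, hwV, F, hF⟩ := hu w hw
  rw [quotEnergyDensity_eq B hV hF hwV]
  have key : ∀ v : ℂ, maurerCartan (fun x => cartanEmbedding h (u x)) w v =
      maurerCartan (fun x => F x * h * (F x)⁻¹) w v :=
    maurerCartan_congr hV (fun x hx => by rw [hF.2 x hx, cartanEmbedding_mk]) hwV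
  simp only [energyDensity, liftEnergyDensity, key, normSq_pPart_maurerCartan B hV hF.1 hwV]
  ring

theorem QuotSmoothOn.smoothOn {h : G} {u : E → SymSpace h} {U : Set E} (hu : QuotSmoothOn u U) :
    SmoothOn (fun x => cartanEmbedding h (u x)) U := by
  intro w hw
  obtain ⟨V, hV, hwV, F, hF⟩ := hu w hw
  have h1 : SmoothOn (fun x => cartanEmbedding h (u x)) V :=
    (hF.1.conj h).congr fun x hx => by rw [hF.2 x hx, cartanEmbedding_mk]
  exact (h1.contDiffAt hV hwV).contDiffWithinAt

end CartanHarmonic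

namespace CartanHarmonic

/-! ### Differentiation under the integral and integration by parts. -/

section calculus

variable {X : Type*} [NormedAddCommGroup X] [NormedSpace ℝ X]

theorem fderiv_slice {g : ℝ × ℂ → X} {t : ℝ} {w : ℂ} (hg : DifferentiableAt ℝ g (t, w)) (v : ℂ) :
    fderiv ℝ (fun x => g (t, x)) w v = fderiv ℝ g (t, w) (0, v) := by
  have h1 : HasFDerivAt (fun x : ℂ => (t, x)) (ContinuousLinearMap.inr ℝ ℝ ℂ) w :=
    hasFDerivAt_prodMk_right t w
  have h2 : HasFDerivAt (fun x => g (t, x)) _ w := HasFDerivAt.comp w hg.hasFDerivAt h1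
  rw [h2.fderiv]
  simp

theorem hasDerivAt_slice {g : ℝ × ℂ → X} {t : ℝ} {w : ℂ} (hg : DifferentiableAt ℝ g (t, w)) :
    HasDerivAt (fun s => g (s, w)) (fderiv ℝ g (t, w) (1, 0)) t := by
  have h1 : HasFDerivAt (fun s : ℝ => (s, w)) (ContinuousLinearMap.inl ℝ ℝ ℂ) t :=
    hasFDerivAt_prodMk_left t w
  have h2 : HasFDerivAt (fun s => g (s, w)) _ t := HasFDerivAt.comp t hg.hasFDerivAt h1
  simpa using h2.hasDerivAt

/-- Differentiation under the integral sign over a compact set. -/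
theorem hasDerivAt_setIntegral_of_contDiffOn {g : ℝ × ℂ → ℝ} {U C : Set ℂ} (hU : IsOpen U)
    (hg : ContDiffOn ℝ ∞ g (univ ×ˢ U)) (hC : IsCompact C) (hCU : C ⊆ U) :
    HasDerivAt (fun t => ∫ w in C, g (t, w)) (∫ w in C, fderiv ℝ g (0, w) (1, 0)) 0 := by
  have hΩ : IsOpen ((univ : Set ℝ) ×ˢ U) := isOpen_univ.prod hU
  have hd : ContinuousOn (fun p => fderiv ℝ g p (1, 0)) (univ ×ˢ U) :=
    (hg.continuousOn_fderiv_of_isOpen hΩ (by simp)).clm_apply continuousOn_const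
  have hslice : ∀ t : ℝ, MapsTo (fun w : ℂ => (t, w)) C ((univ : Set ℝ) ×ˢ U) :=
    fun t w hw => ⟨mem_univ _, hCU hw⟩
  have hcont : ∀ t : ℝ, ContinuousOn (fun w : ℂ => (t, w)) C := fun t => by fun_prop
  obtain ⟨K, hK⟩ := ((isCompact_Icc (a := (-1 : ℝ)) (b := 1)).prod hC).exists_bound_of_continuousOn
    (hd.mono (prod_mono (subset_univ _) hCU))
  refine (hasDerivAt_integral_of_dominated_loc_of_deriv_le (μ := volume.restrict C)
    (F := fun t w => g (t, w)) (F' := fun t w => fderiv ℝ g (t, w) (1, 0)) (bound := fun _ => K)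
    (s := Icc (-1) 1) (Icc_mem_nhds (by norm_num) (by norm_num)) ?_ ?_ ?_ ?_ ?_ ?_).2
  · exact Filter.Eventually.of_forall fun t =>
      (hg.continuousOn.comp (hcont t) (hslice t)).aestronglyMeasurable hC.measurableSet
  · exact (hg.continuousOn.comp (hcont 0) (hslice 0)).integrableOn_compact hC
  · exact (hd.comp (hcont 0) (hslice 0)).aestronglyMeasurable hC.measurableSet
  · exact (ae_restrict_mem hC.measurableSet).mono fun w hw t ht => hK (t, w) ⟨ht, hw⟩
  · exact integrableOn_const hC.measure_lt_top.ne
  · exact (ae_restrict_mem hC.measurableSet).mono fun w hw t _ => hasDerivAt_slice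
      ((hg.contDiffAt (hΩ.mem_nhds (hslice t hw))).differentiableAt (by simp))

/-- Integration by parts against the constant function `1`. -/
theorem integral_fderiv_eq_zero {b : ℂ → ℝ} (hb : ContDiff ℝ ∞ b) (hc : HasCompactSupport b)
    (v : ℂ) : ∫ w, fderiv ℝ b w v = 0 := by
  have h := integral_mul_fderiv_eq_neg_fderiv_mul_of_integrable (μ := (volume : Measure ℂ))
    (f := fun _ : ℂ => (1 : ℝ)) (g := b) (v := v) (by simp)
    (by
      have h1 : Continuous fun w => fderiv ℝ b w v :=
        (hb.continuous_fderiv (by simp)).clm_apply continuous_const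
      simpa using h1.integrable_of_hasCompactSupport (hc.fderiv_apply ℝ v))
    (by simpa using hb.continuous.integrable_of_hasCompactSupport hc)
    (fun _ _ => differentiableAt_const _) (fun w _ => hb.differentiable (by simp) w)
  simpa using h

/-- No regularity of the boundary of `C` is required: extension by zero agrees with `b` on `U` and
vanishes on the open complement of `C`, hence is smooth on all of `ℂ`. -/
theorem setIntegral_fderiv_eq_zero {b : ℂ → ℝ} {U C : Set ℂ} (hU : IsOpen U)
    (hb : ContDiffOn ℝ ∞ b U) (hC : IsCompact C) (hCU : C ⊆ U) (h0 : ∀ w ∈ U \ C, b w = 0)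
    (v : ℂ) : ∫ w in C, fderiv ℝ b w v = 0 := by
  have hU' : ∀ w ∈ U, C.indicator b w = b w := by
    intro w hw
    by_cases hwC : w ∈ C
    · simp [hwC]
    · simp [hwC, h0 w ⟨hw, hwC⟩]
  have hev : ∀ w ∈ U, C.indicator b =ᶠ[nhds w] b := fun w hw => by
    filter_upwards [hU.mem_nhds hw] with x hx using hU' x hx
  have hev0 : ∀ w ∉ C, C.indicator b =ᶠ[nhds w] fun _ => 0 := fun w hw => by
    filter_upwards [hC.isClosed.isOpen_compl.mem_nhds hw] with x hx using indicator_of_notMem hx b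
  have hsm : ContDiff ℝ ∞ (C.indicator b) := by
    rw [contDiff_iff_contDiffAt]
    intro w
    by_cases hw : w ∈ C
    · exact (hb.contDiffAt (hU.mem_nhds (hCU hw))).congr_of_eventuallyEq (hev w (hCU hw))
    · exact contDiffAt_const.congr_of_eventuallyEq (hev0 w hw)
  have hcs : HasCompactSupport (C.indicator b) :=
    HasCompactSupport.intro hC fun w hw => indicator_of_notMem hw b
  have h1 : ∀ w ∉ C, fderiv ℝ (C.indicator b) w v = 0 := fun w hw => by
    rw [(hev0 w hw).fderiv_eq]
    simp
  have h2 : EqOn (fun w => fderiv ℝ b w v) (fun w => fderiv ℝ (C.indicator b) w v) C :=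
    fun w hw => by simp only [(hev w (hCU hw)).fderiv_eq]
  rw [setIntegral_congr_fun hC.measurableSet h2, setIntegral_eq_integral_of_forall_compl_eq_zero h1,
    integral_fderiv_eq_zero hsm hcs v]

end calculus

variable {A : Type*} [NormedRing A] {G : Subgroup Aˣ} [NormedAlgebra ℝ A]
/-- The velocity at time `0` of a variation, translated to the identity. -/
def variationField (Φ : ℝ → ℂ → G) (w : ℂ) : A :=
  mat (Φ 0 w)⁻¹ * deriv (fun t => mat (Φ t w)) 0

/-! ### The first variation of the energy in `G`. -/

section variation

variable {Φ : ℝ → ℂ → G} {U C : Set ℂ}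

/-- Viewing a variation as one map on `ℝ × ℂ` makes the spatial form and the variation field
components of a single Maurer-Cartan form, so the Maurer-Cartan equation can exchange `∂_t` with
`∂_v`. -/
theorem maurerCartan_slice (hU : IsOpen U)
    (hΦ : SmoothOn (fun p : ℝ × ℂ => Φ p.1 p.2) (univ ×ˢ U))
    {t : ℝ} {w : ℂ} (hw : w ∈ U) (v : ℂ) :
    maurerCartan (Φ t) w v = maurerCartan (fun p : ℝ × ℂ => Φ p.1 p.2) (t, w) (0, v) := by
  have h := hΦ.differentiableAt (isOpen_univ.prod hU) (w := (t, w)) ⟨mem_univ _, hw⟩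
  simp only [maurerCartan]
  rw [← fderiv_slice h]

theorem variationField_eq (hU : IsOpen U)
    (hΦ : SmoothOn (fun p : ℝ × ℂ => Φ p.1 p.2) (univ ×ˢ U))
    {w : ℂ} (hw : w ∈ U) :
    variationField Φ w = maurerCartan (fun p : ℝ × ℂ => Φ p.1 p.2) (0, w) (1, 0) := by
  have h := hΦ.differentiableAt (isOpen_univ.prod hU) (w := ((0 : ℝ), w)) ⟨mem_univ _, hw⟩
  simp only [maurerCartan, variationField]
  rw [(hasDerivAt_slice h).deriv]

theorem smoothOn_slice (hΦ : SmoothOn (fun p : ℝ × ℂ => Φ p.1 p.2) (univ ×ˢ U))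
    (t : ℝ) : SmoothOn (Φ t) U :=
  hΦ.comp (f := fun w : ℂ => (t, w)) (by fun_prop) fun _ hw => ⟨mem_univ _, hw⟩

theorem variationField_eq_zero (hΦC : ∀ t, ∀ w ∈ U \ C, Φ t w = Φ 0 w) {w : ℂ} (hw : w ∈ U \ C) :
    variationField Φ w = 0 := by
  have : (fun t => mat (Φ t w)) = fun _ => mat (Φ 0 w) := funext fun t => by rw [hΦC t w hw]
  simp [variationField, this]

variable [FiniteDimensional ℝ A] (B : BiinvariantMetric G)

theorem contDiffOn_variationField (hU : IsOpen U)
    (hΦ : SmoothOn (fun p : ℝ × ℂ => Φ p.1 p.2) (univ ×ˢ U)) :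
    ContDiffOn ℝ ∞ (variationField Φ) U := by
  refine ContDiffOn.congr (ContDiffOn.comp
    (contDiffOn_maurerCartan (isOpen_univ.prod hU) hΦ (1, 0)) (f := fun w : ℂ => ((0 : ℝ), w))
    (by fun_prop) fun _ hw => ⟨mem_univ _, hw⟩) fun w hw => variationField_eq hU hΦ hw

/-- The derivative of the energy density in the direction of a variation. -/
theorem fderiv_extForm_maurerCartan (hU : IsOpen U)
    (hΦ : SmoothOn (fun p : ℝ × ℂ => Φ p.1 p.2) (univ ×ˢ U))
    {w : ℂ} (hw : w ∈ U) (v : ℂ) :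
    fderiv ℝ (fun p => extForm B (maurerCartan (fun p : ℝ × ℂ => Φ p.1 p.2) p (0, v))
        (maurerCartan (fun p : ℝ × ℂ => Φ p.1 p.2) p (0, v))) (0, w) (1, 0) =
      2 * (fderiv ℝ (fun x => extForm B (variationField Φ x) (maurerCartan (Φ 0) x v)) w v -
        extForm B (variationField Φ w) (fderiv ℝ (fun x => maurerCartan (Φ 0) x v) w v)) := by
  set Ψ : ℝ × ℂ → G := fun p => Φ p.1 p.2 with hΨ
  have hΩ : IsOpen ((univ : Set ℝ) ×ˢ U) := isOpen_univ.prod hU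
  have hp : ((0 : ℝ), w) ∈ (univ : Set ℝ) ×ˢ U := ⟨mem_univ _, hw⟩
  have hα := differentiableAt_maurerCartan hΩ hΦ hp (0, v)
  have hη := differentiableAt_maurerCartan hΩ hΦ hp (1, 0)
  have e1 : (fun x => extForm B (variationField Φ x) (maurerCartan (Φ 0) x v)) =ᶠ[nhds w]
      fun x => extForm B (maurerCartan Ψ (0, x) (1, 0)) (maurerCartan Ψ (0, x) (0, v)) := by
    filter_upwards [hU.mem_nhds hw] with x hx
    rw [variationField_eq hU hΦ hx, maurerCartan_slice hU hΦ hx]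
  have e2 : (fun x => maurerCartan (Φ 0) x v) =ᶠ[nhds w] fun x => maurerCartan Ψ (0, x) (0, v) := by
    filter_upwards [hU.mem_nhds hw] with x hx
    rw [maurerCartan_slice hU hΦ hx]
  have hB1 := (((extForm B).hasFDerivAt.comp ((0 : ℝ), w) hα.hasFDerivAt).clm_apply
    hα.hasFDerivAt)
  have hB2 := (((extForm B).hasFDerivAt.comp ((0 : ℝ), w) hη.hasFDerivAt).clm_apply
    hα.hasFDerivAt)
  rw [e1.fderiv_eq, e2.fderiv_eq, fderiv_slice hα, variationField_eq hU hΦ hw,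
    fderiv_slice (g := fun p => extForm B (maurerCartan Ψ p (1, 0)) (maurerCartan Ψ p (0, v)))
      hB2.differentiableAt]
  -- Here `∂_t α_v = ∂_v η + [α_v, η]`, and the bracket is orthogonal to `α_v`. Hence `∂_t ⟨α_v,
  -- α_v⟩ = 2 ⟨∂_v η, α_v⟩`, which the product rule rewrites as a derivative minus `⟨η, ∂_v α_v⟩`.
  have c := maurerCartan_curl hΩ hΦ hp (0, v) (1, 0)
  have k := extForm_commutator B (maurerCartan_mem hΩ hΦ hp (1, 0))
    (maurerCartan_mem hΩ hΦ hp (0, v))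
  rw [← c] at k
  have f1 : fderiv ℝ (fun p => extForm B (maurerCartan Ψ p (0, v)) (maurerCartan Ψ p (0, v)))
      (0, w) = _ := hB1.fderiv
  have f2 : fderiv ℝ (fun p => extForm B (maurerCartan Ψ p (1, 0)) (maurerCartan Ψ p (0, v)))
      (0, w) = _ := hB2.fderiv
  rw [f1, f2]
  simp only [map_sub, sub_apply, sub_eq_zero] at k
  simp [extForm_comm B (maurerCartan Ψ (0, w) (0, v)), k]
  ring

/-- The first variation formula for the energy. -/
theorem hasDerivAt_energy (hU : IsOpen U)
    (hΦ : SmoothOn (fun p : ℝ × ℂ => Φ p.1 p.2) (univ ×ˢ U))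
    (hC : IsCompact C) (hCU : C ⊆ U)
    (hΦC : ∀ t, ∀ w ∈ U \ C, Φ t w = Φ 0 w) :
    HasDerivAt (fun t => ∫ w in C, energyDensity B (Φ t) w)
      (-∫ w in C, extForm B (variationField Φ w) (tension (Φ 0) w)) 0 := by
  set Ψ : ℝ × ℂ → G := fun p => Φ p.1 p.2 with hΨ
  have hΩ : IsOpen ((univ : Set ℝ) ×ˢ U) := isOpen_univ.prod hU
  have hα : ∀ v : ℂ, ContDiffOn ℝ ∞ (fun p => extForm B (maurerCartan Ψ p (0, v))
      (maurerCartan Ψ p (0, v))) (univ ×ˢ U) := fun v =>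
    ((extForm B).contDiff.comp_contDiffOn (contDiffOn_maurerCartan hΩ hΦ (0, v))).clm_apply
      (contDiffOn_maurerCartan hΩ hΦ (0, v))
  have h := hasDerivAt_setIntegral_of_contDiffOn hU
    (g := fun p => (1 / 2 : ℝ) * (extForm B (maurerCartan Ψ p (0, 1)) (maurerCartan Ψ p (0, 1)) +
      extForm B (maurerCartan Ψ p (0, Complex.I)) (maurerCartan Ψ p (0, Complex.I))))
    (contDiffOn_const.mul ((hα 1).add (hα Complex.I))) hC hCU
  have hb : ∀ v : ℂ, ContDiffOn ℝ ∞
      (fun x => extForm B (variationField Φ x) (maurerCartan (Φ 0) x v)) U := fun v =>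
    ((extForm B).contDiff.comp_contDiffOn (contDiffOn_variationField hU hΦ)).clm_apply
      (contDiffOn_maurerCartan hU (smoothOn_slice hΦ 0) v)
  -- The divergence terms integrate to zero because the variation field vanishes on `U \ C`.
  have hb0 : ∀ v : ℂ, ∫ w in C,
      fderiv ℝ (fun x => extForm B (variationField Φ x) (maurerCartan (Φ 0) x v)) w v = 0 :=
    fun v => setIntegral_fderiv_eq_zero hU (hb v) hC hCU (fun w hw => by
      simp [variationField_eq_zero hΦC hw]) v
  have hint : ∀ v : ℂ, IntegrableOn (fun w =>
      fderiv ℝ (fun x => extForm B (variationField Φ x) (maurerCartan (Φ 0) x v)) w v) C :=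
    fun v => ((((hb v).continuousOn_fderiv_of_isOpen hU (by simp)).clm_apply
      continuousOn_const).mono hCU).integrableOn_compact hC
  have hint' : IntegrableOn (fun w => extForm B (variationField Φ w) (tension (Φ 0) w)) C :=
    ((((extForm B).contDiff.comp_contDiffOn (contDiffOn_variationField hU hΦ)).clm_apply
      (contDiffOn_tension hU (smoothOn_slice hΦ 0))).continuousOn.mono hCU).integrableOn_compact
      hC
  convert! h using 1
  · funext t
    refine setIntegral_congr_fun hC.measurableSet fun w hw => ?_
    have hm : ∀ v, maurerCartan (Φ t) w v ∈ lieAlg G :=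
      maurerCartan_mem hU (smoothOn_slice hΦ t) (hCU hw)
    simp only [energyDensity, normSq_eq_extForm B (hm _)]
    simp only [maurerCartan_slice hU hΦ (hCU hw)]
    rfl
  · have e : EqOn (fun w => fderiv ℝ (fun p => (1 / 2 : ℝ) *
          (extForm B (maurerCartan Ψ p (0, 1)) (maurerCartan Ψ p (0, 1)) +
          extForm B (maurerCartan Ψ p (0, Complex.I)) (maurerCartan Ψ p (0, Complex.I))))
          (0, w) (1, 0))
        (fun w =>
          (fderiv ℝ (fun x => extForm B (variationField Φ x) (maurerCartan (Φ 0) x 1)) w 1 +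
          fderiv ℝ (fun x => extForm B (variationField Φ x) (maurerCartan (Φ 0) x Complex.I)) w
            Complex.I) - extForm B (variationField Φ w) (tension (Φ 0) w)) C := by
      intro w hw
      have hd : ∀ v : ℂ, DifferentiableAt ℝ (fun p => extForm B (maurerCartan Ψ p (0, v))
          (maurerCartan Ψ p (0, v))) (0, w) := fun v =>
        ((hα v).contDiffAt (hΩ.mem_nhds ⟨mem_univ _, hCU hw⟩)).differentiableAt (by simp)
      have f1 := fderiv_extForm_maurerCartan B hU hΦ (hCU hw) 1
      have f2 := fderiv_extForm_maurerCartan B hU hΦ (hCU hw) Complex.I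
      have f3 := (((hd 1).hasFDerivAt.fun_add (hd Complex.I).hasFDerivAt).const_mul (1 / 2 : ℝ)).fderiv
      simp only
      rw [f3]
      simp only [smul_apply, add_apply, tension, map_add, smul_eq_mul]
      rw [f1, f2]
      ring
    have hadd : IntegrableOn (fun w =>
        fderiv ℝ (fun x => extForm B (variationField Φ x) (maurerCartan (Φ 0) x 1)) w 1 +
        fderiv ℝ (fun x => extForm B (variationField Φ x) (maurerCartan (Φ 0) x Complex.I)) w
          Complex.I) C := (hint 1).add (hint Complex.I)
    rw [setIntegral_congr_fun hC.measurableSet e, integral_sub hadd hint',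
      integral_add (hint 1) (hint Complex.I), hb0, hb0]
    simp

end variation

end CartanHarmonic

namespace CartanHarmonic

variable {A : Type*} [NormedRing A] {G : Subgroup Aˣ}

/-! ### Harmonicity and vanishing tension, in `G` and in `G / K`. -/

theorem cartanEmbedding_smul {h : G} (g : G) (x : SymSpace h) :
    cartanEmbedding h (g • x) = g * cartanEmbedding h x * g⁻¹ := by
  induction x using QuotientGroup.induction_on with | H a => ?_
  change g * a * h * (g * a)⁻¹ = g * (a * h * a⁻¹) * g⁻¹
  group

theorem cartanEmbedding_mul_self {h : G} (hsq : h * h = 1) (x : SymSpace h) :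
    cartanEmbedding h x * cartanEmbedding h x = 1 := by
  induction x using QuotientGroup.induction_on with | H a => ?_
  calc a * h * a⁻¹ * (a * h * a⁻¹) = a * (h * h) * a⁻¹ := by group
    _ = 1 := by simp [hsq]

variable [NormedAlgebra ℝ A]

theorem QuotSmoothOn.slice {h : G} {Φ : ℝ → ℂ → SymSpace h} {U : Set ℂ}
    (hΦ : QuotSmoothOn (fun p : ℝ × ℂ => Φ p.1 p.2) (univ ×ˢ U)) (t : ℝ) :
    QuotSmoothOn (Φ t) U := by
  intro w hw
  obtain ⟨V, hV, hwV, F, hF⟩ := hΦ (t, w) ⟨mem_univ _, hw⟩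
  have hc : Continuous fun x : ℂ => (t, x) := by fun_prop
  exact ⟨(fun x : ℂ => (t, x)) ⁻¹' V, hV.preimage hc, hwV, fun x => F (t, x),
    hF.1.comp (f := fun x : ℂ => (t, x)) (by fun_prop) fun _ hx => hx, fun x hx => hF.2 (t, x) hx⟩

/-- If `u² = e`, then conjugation by `u` changes the sign of the Maurer-Cartan form. -/
theorem conj_maurerCartan_of_mul_self {E : Type*} [NormedAddCommGroup E] [NormedSpace ℝ E]
    {u : E → G} {U : Set E} (hU : IsOpen U) (hu : SmoothOn u U) (hsq : ∀ w ∈ U, u w * u w = 1)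
    {w : E} (hw : w ∈ U) (v : E) :
    mat (u w) * maurerCartan u w v * mat (u w) = -maurerCartan u w v := by
  have hd := (hu.differentiableAt hU hw).hasFDerivAt
  have e1 : (fun x => mat (u x) * mat (u x)) =ᶠ[nhds w] fun _ => 1 := by
    filter_upwards [hU.mem_nhds hw] with x hx
    rw [← mat_mul, hsq x hx, mat_one]
  have e2 := (hd.mul' hd).unique ((hasFDerivAt_const (1 : A) w).congr_of_eventuallyEq e1)
  have e3 := congrArg (fun L => L v) e2
  have e4 : mat (u w) * fderiv ℝ (fun x => mat (u x)) w v +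
      fderiv ℝ (fun x => mat (u x)) w v * mat (u w) = 0 := by simpa using e3
  have e5 : (u w)⁻¹ = u w := inv_eq_of_mul_eq_one_left (hsq w hw)
  have e6 : mat (u w) * mat (u w) = 1 := by rw [← mat_mul, hsq w hw, mat_one]
  simp only [maurerCartan, e5]
  rw [← mul_assoc (mat (u w)) (mat (u w)), e6, one_mul, eq_neg_iff_add_eq_zero, add_comm]
  exact e4

variable [FiniteDimensional ℝ A] (B : BiinvariantMetric G)

theorem harmonicOn_of_tension_eq_zero {u : ℂ → G} {U : Set ℂ} (hU : IsOpen U) (hu : SmoothOn u U)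
    (h0 : ∀ w ∈ U, tension u w = 0) : HarmonicOn B u U := by
  refine ⟨hu, fun Φ hΦ hΦ0 C hC hCU hΦC => ?_⟩
  have h := hasDerivAt_energy B hU hΦ hC hCU fun t w hw => by rw [hΦC t w hw, hΦ0 w hw.1]
  have e : ∫ w in C, extForm B (variationField Φ w) (tension (Φ 0) w) = 0 := by
    rw [setIntegral_congr_fun (g := fun _ => (0 : ℝ)) hC.measurableSet fun w hw => ?_]
    · simp
    · simp only [tension_congr hU hΦ0 (hCU hw), h0 w (hCU hw), map_zero]
  simpa [e] using h

theorem setIntegral_quotEnergyDensity {h : G} {u : ℂ → SymSpace h} {U C : Set ℂ}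
    (hu : QuotSmoothOn u U) (hC : IsCompact C) (hCU : C ⊆ U) :
    ∫ w in C, quotEnergyDensity B u w =
      1 / 4 * ∫ w in C, energyDensity B (fun x => cartanEmbedding h (u x)) w := by
  rw [← integral_const_mul]
  exact setIntegral_congr_fun hC.measurableSet fun w hw =>
    quotEnergyDensity_eq_energyDensity B hu (hCU hw)

/-- The formal direction: variations in `G / K` embed among those in `G`, with proportional
energies. The converse cannot be had this way, since `G` admits more variations. -/
theorem quotHarmonicOn_of_harmonicOn {h : G} {u : ℂ → SymSpace h} {U : Set ℂ}
    (hu : QuotSmoothOn u U) (hH : HarmonicOn B (fun w => cartanEmbedding h (u w)) U) :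
    QuotHarmonicOn B u U := by
  refine ⟨hu, fun Φ hΦ hΦ0 C hC hCU hΦC => ?_⟩
  have h1 := hH.critical (fun t w => cartanEmbedding h (Φ t w)) hΦ.smoothOn
    (fun w hw => by rw [hΦ0 w hw]) C hC hCU (fun t w hw => by rw [hΦC t w hw])
  simp only [setIntegral_quotEnergyDensity B (hΦ.slice _) hC hCU]
  simpa using h1.const_mul (1 / 4 : ℝ)

/-- Differentiate `u α u = -α`. With `du = u α` the two extra terms are `u α u α = -α²` and `u α² u
= α²`, which cancel. Geometrically, the tension of a map into the involutions is tangent to them. -/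
theorem conj_tension_of_mul_self {u : ℂ → G} {U : Set ℂ} (hU : IsOpen U) (hu : SmoothOn u U)
    (hsq : ∀ w ∈ U, u w * u w = 1) {w : ℂ} (hw : w ∈ U) :
    mat (u w) * tension u w * mat (u w) = -tension u w := by
  have e6 : mat (u w) * mat (u w) = 1 := by rw [← mat_mul, hsq w hw, mat_one]
  have e5 : (u w)⁻¹ = u w := inv_eq_of_mul_eq_one_left (hsq w hw)
  have key : ∀ v : ℂ, mat (u w) * fderiv ℝ (fun x => maurerCartan u x v) w v * mat (u w) =
      -fderiv ℝ (fun x => maurerCartan u x v) w v := by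
    intro v
    have hd := (hu.differentiableAt hU hw).hasFDerivAt
    have hα := (differentiableAt_maurerCartan hU hu hw v).hasFDerivAt
    have e1 : (fun x => mat (u x) * maurerCartan u x v * mat (u x)) =ᶠ[nhds w]
        fun x => -maurerCartan u x v := by
      filter_upwards [hU.mem_nhds hw] with x hx
      exact conj_maurerCartan_of_mul_self hU hu hsq hx v
    have e2 := ((hd.mul' hα).mul' hd).unique (hα.fun_neg.congr_of_eventuallyEq e1)
    have e3 := congrArg (fun L => L v) e2
    have e4 : mat (u w) * maurerCartan u w v * fderiv ℝ (fun x => mat (u x)) w v +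
        (mat (u w) * fderiv ℝ (fun x => maurerCartan u x v) w v +
          fderiv ℝ (fun x => mat (u x)) w v * maurerCartan u w v) * mat (u w) =
        -fderiv ℝ (fun x => maurerCartan u x v) w v := by simpa [add_mul] using e3
    have e7 : fderiv ℝ (fun x => mat (u x)) w v = mat (u w) * maurerCartan u w v := by
      simp [maurerCartan]
    have c := conj_maurerCartan_of_mul_self hU hu hsq hw v
    rw [e7] at e4
    set m := mat (u w)
    set a := maurerCartan u w v
    set d := fderiv ℝ (fun x => maurerCartan u x v) w v
    have e8 : m * a * (m * a) = -(a * a) := by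
      rw [← mul_assoc, c, neg_mul]
    have e9 : m * a * a * m = a * a := by
      calc m * a * a * m = (m * a) * 1 * (a * m) := by noncomm_ring
        _ = (m * a * m) * (m * a * m) := by rw [← e6]; noncomm_ring
        _ = a * a := by rw [c]; noncomm_ring
    rw [← e4, e8, add_mul, e9]
    abel
  simp only [tension, mul_add, add_mul, key]
  abel

/-- Moving `u` by the group action along curves in `G` produces enough variations inside `G / K`:
their fields span the directions `Ad(c⁻¹) X - X`, and the tension is determined by its products with
these because `Ad(c)` changes its sign. -/
theorem tension_eq_zero_of_quotHarmonicOn {h : G} (hsq : h * h = 1) {u : ℂ → SymSpace h}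
    {U : Set ℂ} (hU : IsOpen U) (hu : QuotHarmonicOn B u U) {w : ℂ} (hw : w ∈ U) :
    tension (fun x => cartanEmbedding h (u x)) w = 0 := by
  have : CompleteSpace A := FiniteDimensional.complete ℝ A
  set c : ℂ → G := fun x => cartanEmbedding h (u x) with hc
  have hcs : SmoothOn c U := hu.smooth.smoothOn
  have hc2 : ∀ x, c x * c x = 1 := fun x => cartanEmbedding_mul_self hsq (u x)
  refine eq_zero_of_extForm B (tension_mem hU hcs hw) fun X hX => ?_
  obtain ⟨γ, hγ, hγ0, hγX⟩ := id hX
  set g : ℂ → ℝ := fun x => extForm B (mat (c x)⁻¹ * X * mat (c x) - X) (tension c x) with hg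
  have hgs : ContDiffOn ℝ ∞ g U := by
    have h1 : ContDiffOn ℝ ∞ (fun x => mat (c x)⁻¹) U := hcs.inv
    have h2 : ContDiffOn ℝ ∞ (fun x => mat (c x)) U := hcs
    exact ((extForm B).contDiff.comp_contDiffOn
      (((h1.mul contDiffOn_const).mul h2).sub contDiffOn_const)).clm_apply
      (contDiffOn_tension hU hcs)
  -- Criticality under `γ(t φ) u`, whose image `γ c γ⁻¹` has variation field `φ (c⁻¹ X c - X)`.
  have hg0 : ∀ φ : ℂ → ℝ, ContDiff ℝ ∞ φ → HasCompactSupport φ → tsupport φ ⊆ U →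
      ∫ x, φ x • g x = 0 := by
    intro φ hφ hφc hφU
    have hγφ : SmoothOn (fun p : ℝ × ℂ => γ (p.1 * φ p.2)) univ :=
      hγ.comp (f := fun p : ℝ × ℂ => p.1 * φ p.2) (contDiff_fst.mul (hφ.comp contDiff_snd)).contDiffOn
        fun _ _ => mem_univ _
    have hΦ : QuotSmoothOn (fun p : ℝ × ℂ => γ (p.1 * φ p.2) • u p.2) (univ ×ˢ U) := by
      rintro ⟨t, x⟩ ⟨-, hx⟩
      obtain ⟨V, hV, hxV, F, hF⟩ := hu.smooth x hx
      refine ⟨univ ×ˢ V, isOpen_univ.prod hV, ⟨mem_univ _, hxV⟩,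
        fun p => γ (p.1 * φ p.2) * F p.2, (hγφ.mono (subset_univ _)).mul
        (hF.1.comp (f := fun p : ℝ × ℂ => p.2) contDiffOn_snd fun p hp => hp.2), fun p hp => ?_⟩
      simp only [hF.2 p.2 hp.2]
      rfl
    have hφ0 : ∀ x ∉ tsupport φ, φ x = 0 := fun x hx => image_eq_zero_of_notMem_tsupport hx
    have hcrit := hu.critical (fun t x => γ (t * φ x) • u x) hΦ (fun x _ => by simp [hγ0])
      (tsupport φ) hφc hφU (fun t x hx => by simp [hφ0 x hx.2, hγ0])
    simp only [setIntegral_quotEnergyDensity B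
      (QuotSmoothOn.slice (Φ := fun t x => γ (t * φ x) • u x) hΦ _) hφc hφU] at hcrit
    have hvar := (hasDerivAt_energy B
      (Φ := fun t x => cartanEmbedding h (γ (t * φ x) • u x)) hU hΦ.smoothOn hφc hφU
      (fun t x hx => by simp [hφ0 x hx.2, hγ0])).const_mul (1 / 4 : ℝ)
    have hz := hvar.unique hcrit
    have e : ∀ x, extForm B (variationField (fun t x => cartanEmbedding h (γ (t * φ x) • u x)) x)
        (tension (fun x => cartanEmbedding h (γ (0 * φ x) • u x)) x) = φ x • g x := by
      intro x
      have hγ' : HasDerivAt (fun t => mat (γ (t * φ x))) (φ x • X) 0 := by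
        have h1 : HasDerivAt (fun t : ℝ => t * φ x) (φ x) 0 := by
          simpa using (hasDerivAt_id (0 : ℝ)).mul_const (φ x)
        have h2 : HasDerivAt (fun t => mat (γ t)) X (0 * φ x) := by simpa using hγX
        exact h2.scomp (0 : ℝ) h1
      have hd := hasDerivAt_conj (γ := fun t => γ (t * φ x)) (by simp [hγ0]) hγ' (mat (c x))
      have hd' : deriv (fun t => mat (cartanEmbedding h (γ (t * φ x) • u x))) 0 =
          φ x • X * mat (c x) - mat (c x) * φ x • X := by
        simp only [cartanEmbedding_smul, mat_mul]
        exact hd.deriv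
      have hv : variationField (fun t x => cartanEmbedding h (γ (t * φ x) • u x)) x =
          φ x • (mat (c x)⁻¹ * X * mat (c x) - X) := by
        simp only [variationField, hd']
        simp only [zero_mul, hγ0, one_smul]
        simp [c, mul_sub, smul_sub, mul_assoc]
      rw [hv]
      simp [hγ0, g, c]
    simp only [e] at hz
    rw [← setIntegral_eq_integral_of_forall_compl_eq_zero (s := tsupport φ)
      (fun x hx => by simp [hφ0 x hx])]
    linarith
  -- The fundamental lemma of the calculus of variations gives `g = 0` almost everywhere, and
  -- continuity makes this hold on all of `U`.
  have hae := hU.ae_eq_zero_of_integral_contDiff_smul_eq_zero (μ := volume) (f := g)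
    (hgs.continuousOn.locallyIntegrableOn hU.measurableSet) hg0
  have hgz : EqOn g (fun _ => 0) U := Measure.eqOn_open_of_ae_eq (μ := (volume : Measure ℂ))
    ((ae_restrict_iff' hU.measurableSet).2 hae) hU hgs.continuousOn continuousOn_const
  -- Invariance moves `Ad(c)` onto the tension, where it acts as `-1`; so `g w = 0` becomes `-2 ⟨X,
  -- τ⟩ = 0`.
  have h1 : extForm B (mat (c w)⁻¹ * X * mat (c w)) (tension c w) =
      -extForm B X (tension c w) := by
    have e5 : (c w)⁻¹ = c w := inv_eq_of_mul_eq_one_left (hc2 w)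
    have h2 := extForm_conj B (c w) (conj_mem_lieAlg (c w) hX) (tension_mem hU hcs hw)
    have h3 := conj_tension_of_mul_self hU hcs (fun x _ => hc2 x) hw
    have h4 : mat (c w) * mat (c w) = 1 := by rw [← mat_mul, hc2, mat_one]
    rw [e5] at h2 ⊢
    rw [h3, map_neg] at h2
    rw [← h2]
    congr 3
    rw [← mul_assoc, ← mul_assoc, h4, one_mul, mul_assoc, h4, mul_one]
  have h2 : g w = 0 := hgz hw
  simp only [hg, map_sub, sub_apply, h1] at h2
  linarith

end CartanHarmonic

namespace CartanHarmonic

open NormedSpace Filter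
open scoped Topology

/-! ### The exponential map of the matrix algebra. -/

section exponential

variable {A : Type*} [NormedRing A] [NormedAlgebra ℝ A] [FiniteDimensional ℝ A]

theorem contDiff_normedSpace_exp : ContDiff ℝ ω (exp : A → A) := by
  have : CompleteSpace A := FiniteDimensional.complete ℝ A
  rw [contDiff_iff_contDiffAt]
  exact fun x => (exp_analytic (𝕂 := ℝ) x).contDiffAt

theorem exp_add_smul (X : A) (s t : ℝ) : exp ((s + t) • X) = exp (s • X) * exp (t • X) := by
  have : CompleteSpace A := FiniteDimensional.complete ℝ A
  let _ : NormedAlgebra ℚ A := NormedAlgebra.restrictScalars ℚ ℝ A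
  rw [add_smul]
  exact exp_add_of_commute (((Commute.refl X).smul_left s).smul_right t)

theorem exp_mul_exp_neg (X : A) : exp X * exp (-X) = 1 := by
  simpa using (exp_add_smul X 1 (-1)).symm

theorem exp_neg_mul_exp (X : A) : exp (-X) * exp X = 1 := by
  simpa using exp_mul_exp_neg (-X)

theorem exp_nsmul_eq (n : ℕ) (X : A) : exp (n • X) = exp X ^ n := by
  have : CompleteSpace A := FiniteDimensional.complete ℝ A
  let _ : NormedAlgebra ℚ A := NormedAlgebra.restrictScalars ℚ ℝ A
  exact exp_nsmul n X

theorem exp_mat_conj {G : Subgroup Aˣ} (g : G) (X : A) :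
    exp (mat g * X * mat g⁻¹) = mat g * exp X * mat g⁻¹ := by
  have : CompleteSpace A := FiniteDimensional.complete ℝ A
  let _ : NormedAlgebra ℚ A := NormedAlgebra.restrictScalars ℚ ℝ A
  exact exp_units_conj (g : Aˣ) X

variable (A) in
/-- The exponential map has a smooth local inverse at the identity. -/
theorem exists_localLog : ∃ L : A → A, L 1 = 0 ∧ (∀ᶠ a in 𝓝 1, ContDiffAt ℝ ∞ L a) ∧
    HasFDerivAt L (ContinuousLinearMap.id ℝ A) 1 ∧ (∀ᶠ a in 𝓝 1, exp (L a) = a) ∧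
    ∀ᶠ X in 𝓝 0, L (exp X) = X := by
  have : CompleteSpace A := FiniteDimensional.complete ℝ A
  have hd : HasStrictFDerivAt (exp : A → A)
    ((ContinuousLinearEquiv.refl ℝ A : A ≃L[ℝ] A) : A →L[ℝ] A) 0 := hasStrictFDerivAt_exp_zero
  have hc : ContDiffAt ℝ ω (exp : A → A) 0 := contDiff_normedSpace_exp.contDiffAt
  have h1 := hc.to_localInverse hd.hasFDerivAt (by simp)
  have hd' : HasStrictFDerivAt (exp : A → A)
    ((ContinuousLinearEquiv.refl ℝ A : A ≃L[ℝ] A) : A →L[ℝ] A) 0 :=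
    hc.hasStrictFDerivAt' hd.hasFDerivAt (by simp)
  have h2 := hc.localInverse_apply_image hd.hasFDerivAt (by simp)
  refine ⟨hc.localInverse hd.hasFDerivAt (by simp), ?_, ?_, ?_, ?_, ?_⟩
  · rwa [exp_zero] at h2
  · rw [exp_zero] at h1
    exact (h1.eventually (by simp)).mono fun a ha => ha.of_le le_top
  · have h3 := hd'.to_localInverse.hasFDerivAt
    rw [exp_zero] at h3
    exact h3
  · have h3 := hd'.eventually_right_inverse
    rw [exp_zero] at h3
    exact h3
  · exact hd'.eventually_left_inverse

end exponential

variable {A : Type*} [NormedRing A] {G : Subgroup Aˣ} [NormedAlgebra ℝ A] [FiniteDimensional ℝ A]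

/-! ### The closed subgroup theorem and smooth local lifts. -/

theorem exp_neg_mem {X : A} (hX : exp X ∈ range (mat : G → A)) :
    exp (-X) ∈ range (mat : G → A) := by
  obtain ⟨g, hg⟩ := hX
  refine ⟨g⁻¹, ?_⟩
  rw [← mul_one (mat g⁻¹), ← exp_mul_exp_neg X, ← hg]
  simp

theorem exp_nsmul_mem {X : A} (hX : exp X ∈ range (mat : G → A)) (n : ℕ) :
    exp (n • X) ∈ range (mat : G → A) := by
  obtain ⟨g, hg⟩ := hX
  refine ⟨g ^ n, ?_⟩
  rw [exp_nsmul_eq, ← hg]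
  simp [mat]

/-- `G` is closed in `Aˣ` but perhaps not in `A`. This suffices because the limit `exp X` is itself
a unit and `Aˣ` carries the topology induced from `A`. -/
theorem exp_mem_of_tendsto (hG : IsClosed (G : Set Aˣ)) {α : Type*} {l : Filter α} [NeBot l]
    {f : α → A} {X : A}
    (hf : Tendsto f l (𝓝 (exp X))) (hm : ∀ᶠ a in l, f a ∈ range (mat : G → A)) :
    exp X ∈ range (mat : G → A) := by
  have : CompleteSpace A := FiniteDimensional.complete ℝ A
  have hr : range (mat : G → A) = Units.val '' (G : Set Aˣ) := by
    ext a
    simp [mat]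
  have h1 := mem_closure_of_tendsto hf hm
  let u : Aˣ := ⟨exp X, exp (-X), exp_mul_exp_neg X, exp_neg_mul_exp X⟩
  have h2 : u ∈ closure (G : Set Aˣ) := by
    rw [(Units.isOpenEmbedding_val (R := A)).isEmbedding.closure_eq_preimage_closure_image, ← hr]
    exact h1
  rw [hG.closure_eq] at h2
  exact ⟨⟨u, h2⟩, rfl⟩

/-- Replacing `r` by its integer part costs at most `‖Y‖`, which tends to `0`, and the exponential
of an integer multiple of `Y` is a power of an element of `G`. -/
theorem exp_mem_of_tendsto_smul (hG : IsClosed (G : Set Aˣ)) {α : Type*} {l : Filter α} [NeBot l]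
    {Y : α → A} {r : α → ℝ} {X : A}
    (hY : Tendsto Y l (𝓝 0)) (hm : ∀ᶠ a in l, exp (Y a) ∈ range (mat : G → A))
    (hr : ∀ᶠ a in l, 0 ≤ r a) (hrY : Tendsto (fun a => r a • Y a) l (𝓝 X)) :
    exp X ∈ range (mat : G → A) := by
  have h1 : Tendsto (fun a => (r a - ⌊r a⌋₊) • Y a) l (𝓝 0) := by
    rw [tendsto_zero_iff_norm_tendsto_zero] at hY ⊢
    refine squeeze_zero' (Eventually.of_forall fun _ => norm_nonneg _) ?_ hY
    filter_upwards [hr] with a ha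
    rw [norm_smul, Real.norm_eq_abs]
    refine mul_le_of_le_one_left (norm_nonneg _) ?_
    rw [abs_le]
    constructor <;> linarith [Nat.floor_le ha, Nat.lt_floor_add_one (r a)]
  have h2 : Tendsto (fun a => ⌊r a⌋₊ • Y a) l (𝓝 X) := by
    have := hrY.sub h1
    rw [sub_zero] at this
    refine this.congr fun a => ?_
    rw [← sub_smul, sub_sub_cancel, Nat.cast_smul_eq_nsmul]
  refine exp_mem_of_tendsto hG
    ((contDiff_normedSpace_exp.continuous.tendsto X).comp h2) ?_
  filter_upwards [hm] with a ha
  exact exp_nsmul_mem ha _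

/-- The exponential of an element of the Lie algebra of a closed group lies in the group. -/
theorem exp_mem_of_mem_lieAlg (hG : IsClosed (G : Set Aˣ)) {X : A} (hX : X ∈ lieAlg G) :
    exp X ∈ range (mat : G → A) := by
  obtain ⟨γ, -, h0, h⟩ := hX
  obtain ⟨L, hL1, -, hLd, hL, -⟩ := exists_localLog A
  have h1 : mat (γ 0) = 1 := by simp [h0]
  have hc : Tendsto (fun t => mat (γ t)) (𝓝 0) (𝓝 1) := h1 ▸ h.continuousAt.tendsto
  have hd : HasDerivAt (fun t => L (mat (γ t))) X 0 := by
    have hLd' : HasFDerivAt L (ContinuousLinearMap.id ℝ A) (mat (γ 0)) := h1 ▸ hLd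
    exact hLd'.comp_hasDerivAt (0 : ℝ) h
  have hle : 𝓝[>] (0 : ℝ) ≤ 𝓝 0 := nhdsWithin_le_nhds
  have hs := (hasDerivAt_iff_tendsto_slope_zero.1 hd).mono_left
    (nhdsWithin_mono (0 : ℝ) (show Ioi (0 : ℝ) ⊆ {0}ᶜ from fun t ht => ne_of_gt ht))
  -- `t⁻¹ log γ(t)` tends to the velocity `X` as `t` decreases to `0`.
  refine exp_mem_of_tendsto_smul hG (l := 𝓝[>] (0 : ℝ)) (Y := fun t => L (mat (γ t)))
    (r := fun t => t⁻¹) ?_ ?_ ?_ ?_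
  · have := hd.continuousAt.tendsto
    simp only [h1, hL1] at this
    exact this.mono_left hle
  · filter_upwards [(hc.eventually hL).filter_mono hle] with t ht
    rw [ht]
    exact mem_range_self _
  · filter_upwards [self_mem_nhdsWithin] with t (ht : 0 < t)
    positivity
  · simpa [h1, hL1] using hs

theorem mem_lieAlg_of_forall_exp_mem {X : A} (h : ∀ t : ℝ, exp (t • X) ∈ range (mat : G → A)) :
    X ∈ lieAlg G := by
  have : CompleteSpace A := FiniteDimensional.complete ℝ A
  choose γ hγ using h
  refine ⟨γ, ?_, ?_, ?_⟩
  · have : ContDiff ℝ ∞ fun t : ℝ => exp (t • X) :=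
      (contDiff_normedSpace_exp.of_le le_top).comp (contDiff_id.smul contDiff_const)
    simpa only [SmoothOn, hγ] using this.contDiffOn
  · exact mat_injective (by simp [hγ])
  · simp only [hγ]
    simpa using hasDerivAt_exp_smul_const (𝕂 := ℝ) X 0

/-- Near the identity, a closed group is the image of its Lie algebra under the exponential map. -/
theorem eventually_mem_range_exp (hG : IsClosed (G : Set Aˣ)) :
    ∃ Q : A → A, Tendsto Q (𝓝 1) (𝓝 0) ∧
      ∀ᶠ a in 𝓝 1, a ∈ range (mat : G → A) → Q a ∈ lieAlg G ∧ exp (Q a) = a := by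
  have : CompleteSpace A := FiniteDimensional.complete ℝ A
  have : ProperSpace A := FiniteDimensional.proper ℝ A
  let π : A →L[ℝ] A := ((lieAlg G).toSubmodule.subtype ∘ₗ lieProj G).toContinuousLinearMap
  have hπ : ∀ X ∈ lieAlg G, π X = X := fun X hX => congrArg Subtype.val (lieProj_of_mem hX)
  have hπm : ∀ X, π X ∈ lieAlg G := fun X => (lieProj G X).2
  have hππ : ∀ X, π (π X) = π X := fun X => hπ _ (hπm X)
  -- Exponential coordinates adapted to the splitting of `A` into the Lie algebra and the kernel of
  -- `π`; the derivative at `0` is the identity, and `Q` is the local inverse.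
  let P : A → A := fun Z => exp (π Z) * exp (Z - π Z)
  have hP0 : P 0 = 1 := by simp [P]
  have hP : HasStrictFDerivAt P
      ((ContinuousLinearEquiv.refl ℝ A : A ≃L[ℝ] A) : A →L[ℝ] A) 0 := by
    have e0 : HasStrictFDerivAt (exp : A → A) (1 : A →L[ℝ] A) (π 0) := by
      simpa using hasStrictFDerivAt_exp_zero (𝕂 := ℝ) (𝔸 := A)
    have e0' : HasStrictFDerivAt (exp : A → A) (1 : A →L[ℝ] A) ((0 : A) - π 0) := by
      simpa using hasStrictFDerivAt_exp_zero (𝕂 := ℝ) (𝔸 := A)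
    have e1 : HasStrictFDerivAt (fun Z => exp (π Z)) ((1 : A →L[ℝ] A).comp π) 0 :=
      e0.comp (0 : A) π.hasStrictFDerivAt
    have e2 : HasStrictFDerivAt (fun Z => exp (Z - π Z))
        ((1 : A →L[ℝ] A).comp (ContinuousLinearMap.id ℝ A - π)) 0 :=
      e0'.comp (0 : A) ((hasStrictFDerivAt_id (0 : A)).sub π.hasStrictFDerivAt)
    refine (e1.mul' e2).congr_fderiv ?_
    ext Z
    simp
  let Q : A → A := HasStrictFDerivAt.localInverse P _ 0 hP
  have hQt : Tendsto Q (𝓝 1) (𝓝 0) := hP0 ▸ hP.localInverse_tendsto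
  have hPQ : ∀ᶠ a in 𝓝 1, P (Q a) = a := hP0 ▸ hP.eventually_right_inverse
  refine ⟨Q, hQt, ?_⟩
  let Y : A → A := fun a => Q a - π (Q a)
  have hYt : Tendsto Y (𝓝 1) (𝓝 0) := by
    simpa using hQt.sub ((π.continuous.tendsto 0).comp hQt)
  suffices hmain : ∀ᶠ a in 𝓝 1, a ∈ range (mat : G → A) → Y a = 0 by
    filter_upwards [hmain, hPQ] with a ha hPa haG
    have h0 : Q a = π (Q a) := sub_eq_zero.1 (ha haG)
    refine ⟨h0 ▸ hπm (Q a), ?_⟩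
    have h1 : exp (π (Q a)) * exp (Q a - π (Q a)) = a := hPa
    rwa [← h0, sub_self, exp_zero, mul_one] at h1
  -- Otherwise group elements `a` arbitrarily close to `1` have transversal component `Y a ≠ 0`.
  -- Then `exp (Y a) = exp (-π (Q a)) a` lies in `G`, so a limit direction `y` of `Y a / ‖Y a‖`
  -- belongs to the Lie algebra. But `π y = 0`, so `y = 0`, against `‖y‖ = 1`.
  by_contra hcon
  rw [not_eventually] at hcon
  have hcon' := hcon.and_eventually hPQ
  set l : Filter A := 𝓝 1 ⊓ 𝓟 {a | ¬(a ∈ range (mat : G → A) → Y a = 0) ∧ P (Q a) = a} with hl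
  have hne : NeBot l := by
    rw [hl, ← frequently_mem_iff_neBot]
    exact hcon'
  have hmem : ∀ᶠ a in l, exp (Y a) ∈ range (mat : G → A) ∧ Y a ≠ 0 := by
    have : ∀ᶠ a in l, ¬(a ∈ range (mat : G → A) → Y a = 0) ∧ P (Q a) = a :=
      mem_inf_of_right (mem_principal_self _)
    filter_upwards [this] with a ha
    obtain ⟨h1, h2⟩ := ha
    push Not at h1
    refine ⟨?_, h1.2⟩
    obtain ⟨g, hg⟩ := h1.1
    obtain ⟨k, hk⟩ := exp_neg_mem (exp_mem_of_mem_lieAlg hG (hπm (Q a)))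
    have h3 : exp (π (Q a)) * exp (Y a) = a := h2
    refine ⟨k * g, ?_⟩
    rw [mat_mul, hk, hg]
    nth_rewrite 2 [← h3]
    rw [← mul_assoc, exp_neg_mul_exp, one_mul]
  -- The ultrafilter plays the role of a convergent subsequence on the compact unit sphere.
  let U : Ultrafilter A := Ultrafilter.of l
  have hU : (U : Filter A) ≤ l := Ultrafilter.of_le l
  have hUY : Tendsto Y U (𝓝 0) := hYt.mono_left (hU.trans inf_le_left)
  have hs : ((U.map fun a => ‖Y a‖⁻¹ • Y a : Ultrafilter A) : Filter A) ≤
      𝓟 (Metric.sphere 0 1) := by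
    rw [le_principal_iff, Ultrafilter.mem_coe, Ultrafilter.mem_map]
    have : ∀ᶠ a in (U : Filter A), ‖Y a‖⁻¹ • Y a ∈ Metric.sphere (0 : A) 1 := by
      filter_upwards [hU hmem] with a ha
      simp [norm_smul, ha.2]
    exact this
  obtain ⟨y, hy, hUy⟩ := (isCompact_sphere (0 : A) 1).ultrafilter_le_nhds _ hs
  have hUy' : Tendsto (fun a => ‖Y a‖⁻¹ • Y a) U (𝓝 y) := hUy
  have hexp : ∀ t : ℝ, 0 ≤ t → exp (t • y) ∈ range (mat : G → A) := by
    intro t ht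
    refine exp_mem_of_tendsto_smul hG (l := (U : Filter A)) (r := fun a => t * ‖Y a‖⁻¹) hUY
      (Eventually.mono (f := (U : Filter A)) (hU hmem) fun _ ha => ha.1) (Eventually.of_forall fun a => by positivity) ?_
    simpa only [mul_smul] using hUy'.const_smul t
  have hy𝔤 : y ∈ lieAlg G := mem_lieAlg_of_forall_exp_mem fun t => by
    rcases le_total 0 t with ht | ht
    · exact hexp t ht
    · simpa using exp_neg_mem (hexp (-t) (by linarith))
  have hπy : π y = 0 := by
    have h1 := (π.continuous.tendsto y).comp hUy'
    refine tendsto_nhds_unique h1 (tendsto_const_nhds.congr fun a => ?_)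
    simp [Y, hππ]
  rw [hπ y hy𝔤] at hπy
  simp [hπy] at hy

/-- A smooth map with values in the conjugacy class of `h` lifts locally to `G`. -/
theorem exists_local_lift_conj (hG : IsClosed (G : Set Aˣ)) {E : Type*} [NormedAddCommGroup E]
    [NormedSpace ℝ E] {h : G} (hsq : h * h = 1) {f : E → G} {U : Set E} (hU : IsOpen U)
    (hf : SmoothOn f U) (hconj : ∀ w ∈ U, f w ∈ conjClass h) {w₀ : E} (hw₀ : w₀ ∈ U) :
    ∃ V : Set E, IsOpen V ∧ w₀ ∈ V ∧ ∃ F : E → G, SmoothOn F V ∧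
      ∀ w ∈ V, f w = F w * h * (F w)⁻¹ := by
  classical
  obtain ⟨g₀, hg₀⟩ := hconj w₀ hw₀
  have hinv : h⁻¹ = h := inv_eq_of_mul_eq_one_left hsq
  have hf2 : ∀ w ∈ U, f w * f w = 1 := fun w hw => by
    obtain ⟨g, hg⟩ := hconj w hw
    calc f w * f w = g * (h * h) * g⁻¹ := by rw [hg]; group
      _ = 1 := by simp [hsq]
  -- Chosen so that `g₀⁻¹ f g₀ = a h` and `a w₀ = 1`. It remains to solve `k h k⁻¹ = a h`, for which
  -- a square root `k` of `a` with `h k h⁻¹ = k⁻¹` is enough.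
  let a : E → G := fun w => g₀⁻¹ * f w * g₀ * h
  have ha : SmoothOn a U := (((smoothOn_const g₀⁻¹ U).mul hf).mul (smoothOn_const g₀ U)).mul
    (smoothOn_const h U)
  have ha0 : a w₀ = 1 := by
    calc a w₀ = g₀⁻¹ * (g₀ * h * g₀⁻¹) * g₀ * h := by rw [← hg₀]
      _ = h * h := by group
      _ = 1 := hsq
  have hah : ∀ w ∈ U, h * a w * h⁻¹ = (a w)⁻¹ := by
    intro w hw
    rw [eq_inv_iff_mul_eq_one, hinv]
    calc h * (g₀⁻¹ * f w * g₀ * h) * h * (g₀⁻¹ * f w * g₀ * h)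
        = h * g₀⁻¹ * f w * g₀ * (h * h) * g₀⁻¹ * f w * g₀ * h := by group
      _ = h * g₀⁻¹ * (f w * f w) * g₀ * h := by rw [hsq]; group
      _ = 1 := by rw [hf2 w hw, mul_one, inv_mul_cancel_right, hsq]
  have hat : Tendsto (fun w => mat (a w)) (𝓝 w₀) (𝓝 1) := by
    have := (ha.differentiableAt hU hw₀).continuousAt.tendsto
    rwa [ha0, mat_one] at this
  obtain ⟨L, hL1, hLs, hLd, hL, hL'⟩ := exists_localLog A
  obtain ⟨Q, hQt, hQ⟩ := eventually_mem_range_exp (G := G) hG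
  let Y : E → A := fun w => L (mat (a w))
  have hYt : Tendsto Y (𝓝 w₀) (𝓝 0) := by
    have := hLd.continuousAt.tendsto
    rw [hL1] at this
    exact this.comp hat
  have hYn : Tendsto (fun w => -Y w) (𝓝 w₀) (𝓝 0) := by simpa using hYt.neg
  have hYc : Tendsto (fun w => mat h * Y w * mat h⁻¹) (𝓝 w₀) (𝓝 0) := by
    simpa using (hYt.const_mul (mat h)).mul_const (mat h⁻¹)
  -- Local injectivity of `exp` is used twice: `Y` agrees with `Q ∘ a`, hence lies in the Lie
  -- algebra, and `h Y h⁻¹` and `-Y` both exponentiate to `a⁻¹`, hence agree.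
  have hev : ∀ᶠ w in 𝓝 w₀, w ∈ U ∧ ContDiffAt ℝ ∞ L (mat (a w)) ∧ exp (Y w) = mat (a w) ∧
      Y w ∈ lieAlg G ∧ mat h * Y w * mat h⁻¹ = -Y w := by
    filter_upwards [hU.mem_nhds hw₀, hat.eventually hLs, hat.eventually hL, hat.eventually hQ,
      (hQt.comp hat).eventually hL', hYn.eventually hL', hYc.eventually hL'] with w h1 h2 h3 h4 h5
      h6 h7
    obtain ⟨h8, h9⟩ := h4 (mem_range_self _)
    refine ⟨h1, h2, h3, ?_, ?_⟩
    · have : Y w = Q (mat (a w)) := by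
        simp only [Function.comp_apply, h9] at h5
        exact h5
      rwa [this]
    · have e1 : exp (mat h * Y w * mat h⁻¹) = mat (a w)⁻¹ := by
        rw [exp_mat_conj, h3, ← mat_mul, ← mat_mul, hah w h1]
      have e2 : exp (-Y w) = mat (a w)⁻¹ := by
        rw [← mul_one (mat (a w)⁻¹), ← exp_mul_exp_neg (Y w), h3, mat_inv_mul_cancel_left]
      rw [← h7, ← h6, e1, e2]
  obtain ⟨V, hV, hVo, hVw⟩ := eventually_nhds_iff.1 hev
  have hk : ∀ w, ∃ k : G, w ∈ V → mat k = exp ((1 / 2 : ℝ) • Y w) := by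
    intro w
    by_cases hw : w ∈ V
    · obtain ⟨k, hk⟩ := exp_mem_of_mem_lieAlg hG ((lieAlg G).smul_mem (1 / 2 : ℝ)
        (hV w hw).2.2.2.1)
      exact ⟨k, fun _ => hk⟩
    · exact ⟨1, fun hw' => absurd hw' hw⟩
  choose k hk using hk
  refine ⟨V, hVo, hVw, fun w => g₀ * k w, (smoothOn_const g₀ V).mul ?_, ?_⟩
  · have hYs : ContDiffOn ℝ ∞ (fun w => exp ((1 / 2 : ℝ) • Y w)) V := by
      intro w hw
      have hYw : ContDiffAt ℝ ∞ Y w := (hV w hw).2.1.comp w (ha.contDiffAt hU (hV w hw).1)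
      have he : ContDiff ℝ ∞ (exp : A → A) := contDiff_normedSpace_exp.of_le le_top
      exact (he.contDiffAt.comp w (hYw.const_smul (1 / 2 : ℝ))).contDiffWithinAt
    exact hYs.congr fun w hw => hk w hw
  · intro w hw
    obtain ⟨h1, -, h3, -, h5⟩ := hV w hw
    have e1 : k w * k w = a w := by
      apply mat_injective
      rw [mat_mul, hk w hw, ← exp_add_smul, ← h3]
      norm_num
    have e2 : h * k w * h⁻¹ * k w = 1 := by
      apply mat_injective
      rw [mat_mul, mat_mul, mat_mul, hk w hw, ← exp_mat_conj, mul_smul_comm, smul_mul_assoc, h5,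
        smul_neg, exp_neg_mul_exp, mat_one]
    have e3 : h * (k w)⁻¹ = k w * h := by
      rw [← hinv, mul_inv_eq_iff_eq_mul, ← mul_right_inj h]
      rw [hinv] at e2 ⊢
      rw [hsq, ← e2]
      group
    calc f w = g₀ * a w * h * g₀⁻¹ := by
          change f w = g₀ * (g₀⁻¹ * f w * g₀ * h) * h * g₀⁻¹
          calc f w = f w * g₀ * (1 : G) * g₀⁻¹ := by group
            _ = f w * g₀ * (h * h) * g₀⁻¹ := by rw [hsq]
            _ = _ := by group
      _ = g₀ * k w * (k w * h) * g₀⁻¹ := by rw [← e1]; group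
      _ = g₀ * k w * h * (g₀ * k w)⁻¹ := by rw [← e3]; group

theorem quotSmoothOn_of_smoothOn (hG : IsClosed (G : Set Aˣ)) {E : Type*} [NormedAddCommGroup E]
    [NormedSpace ℝ E] {h : G} (hsq : h * h = 1) {u : E → SymSpace h} {U : Set E} (hU : IsOpen U)
    (hu : SmoothOn (fun w => cartanEmbedding h (u w)) U) : QuotSmoothOn u U := by
  intro w hw
  have hc : ∀ x ∈ U, cartanEmbedding h (u x) ∈ conjClass h := fun x _ => by
    induction u x using QuotientGroup.induction_on with | H g => exact ⟨g, rfl⟩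
  obtain ⟨V, hV, hwV, F, hF, hFu⟩ := exists_local_lift_conj hG hsq hU hu hc hw
  exact ⟨V, hV, hwV, F, hF, fun x hx => cartanEmbedding_injective h (hFu x hx)⟩

end CartanHarmonic

namespace CartanHarmonic

variable {A : Type*} [NormedRing A] {G : Subgroup Aˣ}

theorem mat_conj_conj {h : G} (hsq : h * h = 1) (X : A) :
    mat h * (mat h * X * mat h⁻¹) * mat h⁻¹ = X := by
  have h1 : mat h * mat h = 1 := by rw [← mat_mul, hsq, mat_one]
  have h2 : mat h⁻¹ * mat h⁻¹ = 1 := by rw [← mat_mul, ← mul_inv_rev, hsq, inv_one, mat_one]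
  calc mat h * (mat h * X * mat h⁻¹) * mat h⁻¹
      = (mat h * mat h) * X * (mat h⁻¹ * mat h⁻¹) := by noncomm_ring
    _ = X := by rw [h1, h2, one_mul, mul_one]

variable [NormedAlgebra ℝ A]

/-! ### The decomposition `𝔤 = 𝔨 ⊕ 𝔭` -/

/-- The projection onto the `(-1)`-eigenspace, as a continuous linear map. -/
def pPartCLM (h : G) : A →L[ℝ] A :=
  (1 / 2 : ℝ) • (ContinuousLinearMap.id ℝ A -
    ContinuousLinearMap.mulLeftRight ℝ A (mat h) (mat h⁻¹))

theorem pPartCLM_apply (h : G) (X : A) : pPartCLM h X = pPart h X := by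
  simp [pPartCLM, pPart]

/-- Conjugation by `h` is an algebra automorphism, and `XY - X'Y'` is half of `(X + X')(Y - Y') + (X
- X')(Y + Y')`. Used to take the `𝔭`-part of the Maurer-Cartan equation. -/
theorem pPart_mul (h : G) (X Y : A) :
    pPart h (X * Y) = kPart h X * pPart h Y + pPart h X * kPart h Y := by
  have e : mat h * (X * Y) * mat h⁻¹ = mat h * X * mat h⁻¹ * (mat h * Y * mat h⁻¹) := by
    simp only [mul_assoc, mat_inv_mul_cancel_left]
  simp only [pPart, kPart, e, smul_mul_assoc, mul_smul_comm, smul_smul, ← smul_add]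
  rw [show X * Y - mat h * X * mat h⁻¹ * (mat h * Y * mat h⁻¹) = (1 / 2 : ℝ) •
    ((2 : ℝ) • (X * Y - mat h * X * mat h⁻¹ * (mat h * Y * mat h⁻¹))) by simp [smul_smul],
    smul_smul, two_smul]
  congr 1
  noncomm_ring

theorem kPart_add_pPart (h : G) (X : A) : kPart h X + pPart h X = X := by
  simp only [kPart, pPart, ← smul_add]
  rw [add_add_sub_cancel, ← two_smul ℝ, smul_smul]
  norm_num

theorem mat_conj_pPart {h : G} (hsq : h * h = 1) (X : A) :
    mat h * pPart h X * mat h⁻¹ = -pPart h X := by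
  simp only [pPart, mul_smul_comm, smul_mul_assoc, mul_sub, sub_mul]
  rw [← mul_assoc (mat h) (mat h * X), ← mul_assoc (mat h) (mat h),
    show mat h * mat h * X * mat h⁻¹ * mat h⁻¹ = X by
      simpa only [mul_assoc] using mat_conj_conj hsq X, ← smul_neg, neg_sub]

theorem pPart_pPart {h : G} (hsq : h * h = 1) (X : A) : pPart h (pPart h X) = pPart h X := by
  rw [pPart, mat_conj_pPart hsq, sub_neg_eq_add, ← two_smul ℝ, smul_smul]
  norm_num

theorem pPart_kPart {h : G} (hsq : h * h = 1) (X : A) : pPart h (kPart h X) = 0 := by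
  have := congrArg (pPart h) (kPart_add_pPart h X)
  rw [← pPartCLM_apply, map_add, pPartCLM_apply, pPartCLM_apply, pPart_pPart hsq,
    add_eq_right] at this
  exact this

theorem maurerCartan_add_smul {E : Type*} [NormedAddCommGroup E] [NormedSpace ℝ E] (F : E → G)
    (w : E) (a b : ℝ) (v v' : E) :
    maurerCartan F w (a • v + b • v') = a • maurerCartan F w v + b • maurerCartan F w v' := by
  simp [maurerCartan, mul_add]

theorem smul_complexify (z : ℂ) (X : A) : z • complexify X = z ⊗ₜ[ℝ] X := by
  simp [complexify, TensorProduct.smul_tmul']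

/-- The real part of an element of the complexification. -/
def realPart : ℂ ⊗[ℝ] A →ₗ[ℝ] A :=
  TensorProduct.lift ((LinearMap.lsmul ℝ A).comp Complex.reLm)

@[simp] theorem realPart_tmul (z : ℂ) (X : A) : realPart (z ⊗ₜ[ℝ] X) = z.re • X := by
  simp [realPart]

/-- Since `λ⁻¹` is the conjugate of `λ`, the `(1,0)` and `(0,1)` terms are complex conjugate, and
taking real parts leaves an equation in `A`. -/
theorem eq_of_frame_equation {X K : A} {α : ℂ → A} {l : Circle} {v : ℂ}
    (e : complexify X = (l : ℂ)⁻¹ • part10 α v + complexify K + (l : ℂ) • part01 α v) :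
    X = K + ((l : ℂ).re • α v - (l : ℂ).im • α (Complex.I * v)) := by
  have hl : (l : ℂ)⁻¹ = (starRingEnd ℂ) (l : ℂ) := by
    rw [← Circle.coe_inv, Circle.coe_inv_eq_conj]
  have h1 := congrArg realPart e
  rw [hl] at h1
  simp only [part10, part01, smul_sub, smul_add, smul_complexify,
    TensorProduct.smul_tmul', smul_eq_mul, map_add, map_sub, realPart_tmul] at h1
  simp only [complexify, realPart_tmul] at h1
  simp at h1
  rw [h1]
  module

variable [FiniteDimensional ℝ A]

/-- The divergence of the `𝔭`-part of the Maurer-Cartan form of `F`, covariant with respect to its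
`𝔨`-part. -/
def covariantDivergence (h : G) (F : ℂ → G) (w : ℂ) : A :=
  (fderiv ℝ (fun x => pPart h (maurerCartan F x 1)) w 1 +
    (kPart h (maurerCartan F w 1) * pPart h (maurerCartan F w 1) -
      pPart h (maurerCartan F w 1) * kPart h (maurerCartan F w 1))) +
  (fderiv ℝ (fun x => pPart h (maurerCartan F x Complex.I)) w Complex.I +
    (kPart h (maurerCartan F w Complex.I) * pPart h (maurerCartan F w Complex.I) -
      pPart h (maurerCartan F w Complex.I) * kPart h (maurerCartan F w Complex.I)))

section

variable {h : G} {F : ℂ → G} {V : Set ℂ}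

/-- In general the form of `F h F⁻¹` is `2 Ad(F h⁻¹) α_𝔭`; when `h² = e`, `Ad(h⁻¹)` is `-1` on `𝔭`.
-/
theorem maurerCartan_conj (hsq : h * h = 1) (hV : IsOpen V)
    (hF : SmoothOn F V) {w : ℂ} (hw : w ∈ V) (v : ℂ) :
    maurerCartan (fun x => F x * h * (F x)⁻¹) w v =
      (-2 : ℝ) • (mat (F w) * pPart h (maurerCartan F w v) * mat (F w)⁻¹) := by
  have e := pPart_maurerCartan hV hF hw v (h := h)
  have e2 : mat h * pPart h (maurerCartan F w v) * mat h⁻¹ = -pPart h (maurerCartan F w v) :=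
    mat_conj_pPart hsq _
  have e3 : pPart h (maurerCartan F w v) =
      -(mat h * pPart h (maurerCartan F w v) * mat h⁻¹) := by rw [e2, neg_neg]
  have hinv : h⁻¹ = h := inv_eq_of_mul_eq_one_left hsq
  rw [e3, e]
  simp only [mul_smul_comm, smul_mul_assoc, mul_neg, neg_mul, smul_neg, smul_smul]
  norm_num
  simp only [maurerCartan, mul_assoc, mul_inv_rev, inv_inv, mat_mul, hinv]
  have h1 : mat h * mat h = 1 := by rw [← mat_mul, hsq, mat_one]
  have h2 : ∀ X : A, mat h * (mat h * X) = X := fun X => by rw [← mul_assoc, h1, one_mul]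
  rw [h2]
  simp

theorem differentiableAt_pPart_maurerCartan (hV : IsOpen V) (hF : SmoothOn F V) {w : ℂ}
    (hw : w ∈ V) (v : ℂ) : DifferentiableAt ℝ (fun x => pPart h (maurerCartan F x v)) w := by
  simp only [← pPartCLM_apply]
  exact (pPartCLM h).differentiableAt.comp w (differentiableAt_maurerCartan hV hF hw v)

theorem fderiv_pPart_maurerCartan (hV : IsOpen V) (hF : SmoothOn F V) {w : ℂ}
    (hw : w ∈ V) (v v' : ℂ) : fderiv ℝ (fun x => pPart h (maurerCartan F x v)) w v' =
      pPart h (fderiv ℝ (fun x => maurerCartan F x v) w v') := by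
  simp only [← pPartCLM_apply]
  have hd : HasFDerivAt (fun x => pPartCLM h (maurerCartan F x v)) _ w :=
    (pPartCLM h).hasFDerivAt.comp w (differentiableAt_maurerCartan hV hF hw v).hasFDerivAt
  rw [hd.fderiv]
  rfl

/-- Differentiating `Ad(F) α_𝔭` produces `Ad(F)` of `∂_v α_𝔭 + [α, α_𝔭]`, and `[α_𝔭, α_𝔭] = 0` when
both are evaluated on the same `v`, leaving only the bracket with `α_𝔨`. -/
theorem tension_conj (hsq : h * h = 1) (hV : IsOpen V) (hF : SmoothOn F V) {w : ℂ} (hw : w ∈ V) :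
    tension (fun x => F x * h * (F x)⁻¹) w =
      (-2 : ℝ) • (mat (F w) * covariantDivergence h F w * mat (F w)⁻¹) := by
  have key : ∀ v : ℂ, fderiv ℝ (fun x => maurerCartan (fun x => F x * h * (F x)⁻¹) x v) w v =
      (-2 : ℝ) • (mat (F w) * (fderiv ℝ (fun x => pPart h (maurerCartan F x v)) w v +
        (kPart h (maurerCartan F w v) * pPart h (maurerCartan F w v) -
          pPart h (maurerCartan F w v) * kPart h (maurerCartan F w v))) * mat (F w)⁻¹) := by
    intro v
    have e : (fun x => maurerCartan (fun x => F x * h * (F x)⁻¹) x v) =ᶠ[nhds w] fun x =>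
        (-2 : ℝ) • (mat (F x) * pPart h (maurerCartan F x v) * mat (F x)⁻¹) := by
      filter_upwards [hV.mem_nhds hw] with x hx using maurerCartan_conj hsq hV hF hx v
    have hd := (hF.differentiableAt hV hw).hasFDerivAt
    have hp := (differentiableAt_pPart_maurerCartan (h := h) hV hF hw v).hasFDerivAt
    have h1 : HasFDerivAt (fun x =>
        (-2 : ℝ) • (mat (F x) * pPart h (maurerCartan F x v) * mat (F x)⁻¹)) _ w :=
      ((hd.mul' hp).mul' (hasFDerivAt_mat_inv hd)).const_smul (-2 : ℝ)
    rw [e.fderiv_eq, h1.fderiv]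
    set D := fderiv ℝ (fun x => mat (F x)) w v with hD
    have e7 : D = mat (F w) * maurerCartan F w v := by simp [maurerCartan, hD]
    set P := fderiv ℝ (fun x => pPart h (maurerCartan F x v)) w v with hP
    have e8 : (kPart h (maurerCartan F w v) * pPart h (maurerCartan F w v) -
          pPart h (maurerCartan F w v) * kPart h (maurerCartan F w v)) =
        maurerCartan F w v * pPart h (maurerCartan F w v) -
          pPart h (maurerCartan F w v) * maurerCartan F w v := by
      nth_rewrite 5 [← kPart_add_pPart h (maurerCartan F w v)]
      nth_rewrite 9 [← kPart_add_pPart h (maurerCartan F w v)]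
      noncomm_ring
    rw [e8]
    simp [← hD, ← hP, e7, mul_add, add_mul, mul_sub, sub_mul, mul_assoc]
    module
  simp only [tension, key, covariantDivergence, ← smul_add, ← add_mul, ← mul_add]

end

/-! ### Holomorphic changes of the variable -/

/-- Conformal invariance in dimension two: the terms with `φ''` cancel since `1² + i² = 0`, the
mixed derivatives cancel since `φ'` acts by complex multiplication, and the rest is scaled by
`|φ'|²`. -/
theorem tension_comp {u : ℂ → G} {U W : Set ℂ} (hU : IsOpen U) (hW : IsOpen W)
    (hu : SmoothOn u U) {φ : ℂ → ℂ} (hφ : DifferentiableOn ℂ φ W) (hm : MapsTo φ W U) {w : ℂ}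
    (hw : w ∈ W) :
    tension (fun x => u (φ x)) w =
      ((deriv φ w).re ^ 2 + (deriv φ w).im ^ 2) • tension u (φ w) := by
  have hφd : ∀ x ∈ W, HasFDerivAt φ (ContinuousLinearMap.mul ℝ ℂ (deriv φ x)) x := by
    intro x hx
    have h1 := ((hφ x hx).differentiableAt (hW.mem_nhds hx)).hasDerivAt.hasFDerivAt.restrictScalars ℝ
    refine h1.congr_fderiv ?_
    ext
    simp [mul_comm]
  have hgd : HasFDerivAt (deriv φ) (ContinuousLinearMap.mul ℝ ℂ (deriv (deriv φ) w)) w := by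
    have h1 := (((hφ.deriv hW) w hw).differentiableAt
      (hW.mem_nhds hw)).hasDerivAt.hasFDerivAt.restrictScalars ℝ
    refine h1.congr_fderiv ?_
    ext
    simp [mul_comm]
  have hmc : ∀ x ∈ W, ∀ v : ℂ, maurerCartan (fun x => u (φ x)) x v =
      (deriv φ x * v).re • maurerCartan u (φ x) 1 +
        (deriv φ x * v).im • maurerCartan u (φ x) Complex.I := by
    intro x hx v
    have h1 : HasFDerivAt (fun x => mat (u (φ x))) _ x :=
      (hu.differentiableAt hU (hm hx)).hasFDerivAt.comp x (hφd x hx)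
    rw [← maurerCartan_add_smul, maurerCartan, h1.fderiv, maurerCartan]
    have h2 : deriv φ x * v = (deriv φ x * v).re • (1 : ℂ) + (deriv φ x * v).im • Complex.I := by
      simpa using (Complex.re_add_im (deriv φ x * v)).symm
    rw [← h2]
    simp
  have hα : ∀ a : ℂ, HasFDerivAt (fun x => maurerCartan u (φ x) a)
      ((fderiv ℝ (fun x => maurerCartan u x a) (φ w)).comp
        (ContinuousLinearMap.mul ℝ ℂ (deriv φ w))) w := fun a =>
    HasFDerivAt.comp (g := fun x => maurerCartan u x a) w
      (differentiableAt_maurerCartan hU hu (hm hw) a).hasFDerivAt (hφd w hw)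
  have key : ∀ v : ℂ, fderiv ℝ (fun x => maurerCartan (fun x => u (φ x)) x v) w v =
      ((deriv φ w * v).re • fderiv ℝ (fun x => maurerCartan u x 1) (φ w) (deriv φ w * v) +
        (deriv (deriv φ) w * v * v).re • maurerCartan u (φ w) 1) +
      ((deriv φ w * v).im • fderiv ℝ (fun x => maurerCartan u x Complex.I) (φ w) (deriv φ w * v) +
        (deriv (deriv φ) w * v * v).im • maurerCartan u (φ w) Complex.I) := by
    intro v
    have e : (fun x => maurerCartan (fun x => u (φ x)) x v) =ᶠ[nhds w] fun x =>
        (deriv φ x * v).re • maurerCartan u (φ x) 1 +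
          (deriv φ x * v).im • maurerCartan u (φ x) Complex.I := by
      filter_upwards [hW.mem_nhds hw] with x hx using hmc x hx v
    have hgv := hgd.mul_const' v
    have hre : HasFDerivAt (fun x => (deriv φ x * v).re) _ w :=
      Complex.reCLM.hasFDerivAt.comp w hgv
    have him : HasFDerivAt (fun x => (deriv φ x * v).im) _ w :=
      Complex.imCLM.hasFDerivAt.comp w hgv
    have h1 : HasFDerivAt (fun x => (deriv φ x * v).re • maurerCartan u (φ x) 1 +
          (deriv φ x * v).im • maurerCartan u (φ x) Complex.I) _ w :=
      (hre.fun_smul (hα 1)).fun_add (him.fun_smul (hα Complex.I))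
    rw [e.fderiv_eq, h1.fderiv]
    simp
    module
  have hlin : ∀ (T : ℂ →L[ℝ] A) (z : ℂ), T z = z.re • T 1 + z.im • T Complex.I := by
    intro T z
    rw [← map_smul, ← map_smul, ← map_add]
    congr 1
    simp
  simp only [tension, key]
  rw [hlin _ (deriv φ w * 1), hlin _ (deriv φ w * Complex.I),
    hlin (fderiv ℝ (fun x => maurerCartan u x Complex.I) (φ w)) (deriv φ w * 1),
    hlin (fderiv ℝ (fun x => maurerCartan u x Complex.I) (φ w)) (deriv φ w * Complex.I)]
  simp
  module

/-! ### The associated family -/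

theorem covariantDivergence_frame {h : G} (hsq : h * h = 1) {F H : ℂ → G} {V : Set ℂ}
    (hV : IsOpen V) (hF : SmoothOn F V) (c s : ℝ)
    (hH : ∀ x ∈ V, ∀ v : ℂ, maurerCartan H x v = kPart h (maurerCartan F x v) +
      (c • pPart h (maurerCartan F x v) - s • pPart h (maurerCartan F x (Complex.I * v))))
    {w : ℂ} (hw : w ∈ V) :
    covariantDivergence h H w = c • covariantDivergence h F w := by
  have hp : ∀ x ∈ V, ∀ v : ℂ, pPart h (maurerCartan H x v) =
      c • pPart h (maurerCartan F x v) - s • pPart h (maurerCartan F x (Complex.I * v)) := by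
    intro x hx v
    rw [hH x hx v]
    simp only [← pPartCLM_apply, map_add, map_sub, map_smul]
    simp only [pPartCLM_apply, pPart_kPart hsq, pPart_pPart hsq, zero_add]
  have hk : ∀ x ∈ V, ∀ v : ℂ, kPart h (maurerCartan H x v) = kPart h (maurerCartan F x v) := by
    intro x hx v
    have h1 := kPart_add_pPart h (maurerCartan H x v)
    rw [hp x hx v] at h1
    nth_rewrite 2 [hH x hx v] at h1
    exact add_right_cancel h1
  have hI : ∀ x, maurerCartan F x (Complex.I * Complex.I) = -maurerCartan F x 1 := by
    intro x
    rw [Complex.I_mul_I]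
    simp [maurerCartan]
  have hneg : ∀ X : A, pPart h (-X) = -pPart h X := fun X => by
    rw [← pPartCLM_apply, map_neg, pPartCLM_apply]
  have hd : ∀ v v' : ℂ, fderiv ℝ (fun x => pPart h (maurerCartan H x v)) w v' =
      c • fderiv ℝ (fun x => pPart h (maurerCartan F x v)) w v' -
        s • fderiv ℝ (fun x => pPart h (maurerCartan F x (Complex.I * v))) w v' := by
    intro v v'
    have e : (fun x => pPart h (maurerCartan H x v)) =ᶠ[nhds w] fun x =>
        c • pPart h (maurerCartan F x v) - s • pPart h (maurerCartan F x (Complex.I * v)) := by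
      filter_upwards [hV.mem_nhds hw] with x hx using hp x hx v
    have h1 := ((differentiableAt_pPart_maurerCartan (h := h) hV hF hw v).hasFDerivAt.fun_const_smul
      c).fun_sub ((differentiableAt_pPart_maurerCartan (h := h) hV hF hw
        (Complex.I * v)).hasFDerivAt.fun_const_smul s)
    rw [e.fderiv_eq, h1.fderiv]
    simp
  have hdI : fderiv ℝ (fun x => pPart h (maurerCartan F x (Complex.I * Complex.I))) w Complex.I =
      -fderiv ℝ (fun x => pPart h (maurerCartan F x 1)) w Complex.I := by
    simp only [hI, hneg, fderiv_fun_neg]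
    rfl
  -- The coefficient of `s` in the divergence of `H` is `∂_1 p_i - ∂_i p_1 + [k_1, p_i] - [k_i,
  -- p_1]`, where `p`, `k` are the parts of the form of `F`. It vanishes by the `𝔭`-part of the
  -- Maurer-Cartan equation.
  have curl := congrArg (pPart h) (maurerCartan_curl hV hF hw 1 Complex.I)
  rw [← pPartCLM_apply, map_sub, pPartCLM_apply, pPartCLM_apply, ← fderiv_pPart_maurerCartan hV hF hw,
    ← fderiv_pPart_maurerCartan hV hF hw, ← pPartCLM_apply, map_sub, pPartCLM_apply, pPartCLM_apply,
    pPart_mul, pPart_mul, sub_eq_iff_eq_add] at curl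
  have curl_symm := (eq_sub_of_add_eq' curl.symm)
  have hd1 := hd 1 1
  have hd2 := hd Complex.I Complex.I
  rw [mul_one, curl_symm] at hd1
  rw [hdI] at hd2
  simp only [covariantDivergence, hk w hw, hp w hw, hd1, hd2, hI, hneg, mul_one]
  simp only [smul_sub, smul_add, mul_sub, sub_mul, mul_smul_comm, smul_mul_assoc, smul_neg, mul_neg,
    neg_mul]
  module

end CartanHarmonic

namespace CartanHarmonic

/-! ### Riemann surfaces: the bijection, the covering and the associated family. -/

variable {A : Type*} [NormedRing A] {G : Subgroup Aˣ}

theorem mul_self_eq_one_of_conj_conj (hcenter : Subgroup.center G = ⊥) {h : G}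
    (hh : ∀ g : G, MulAut.conj h (MulAut.conj h g) = g) : h * h = 1 := by
  have hc : h * h ∈ Subgroup.center G := by
    rw [Subgroup.mem_center_iff]
    intro g
    have h1 := hh g
    simp only [MulAut.conj_apply] at h1
    calc g * (h * h) = h * (h * g * h⁻¹) * h⁻¹ * (h * h) := by rw [h1]
      _ = h * h * g := by group
  rwa [hcenter, Subgroup.mem_bot] at hc

theorem bijOn_cartanEmbedding (h : G) : BijOn (cartanEmbedding h) univ (conjClass h) := by
  refine ⟨fun x _ => ?_, (cartanEmbedding_injective h).injOn, ?_⟩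
  · induction x using QuotientGroup.induction_on with | H g => exact ⟨g, rfl⟩
  · rintro _ ⟨g, rfl⟩
    exact ⟨(g : SymSpace h), mem_univ _, rfl⟩

variable [NormedAlgebra ℝ A] [FiniteDimensional ℝ A]

section surface

variable {M : Type*} [TopologicalSpace M] [ChartedSpace ℂ M]

theorem tension_eq_zero_of_isQuotHarmonic (B : BiinvariantMetric G) {h : G} (hsq : h * h = 1)
    {f : M → SymSpace h} (hf : IsQuotHarmonic B f) {e : OpenPartialHomeomorph M ℂ}
    (he : e ∈ atlas ℂ M) {w : ℂ} (hw : w ∈ e.target) :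
    tension (fun x => cartanEmbedding h (f (e.symm x))) w = 0 :=
  tension_eq_zero_of_quotHarmonicOn B hsq e.open_target (hf e he) hw

theorem mem_modifiedHarmonic (B : BiinvariantMetric G) {h : G} (hsq : h * h = 1) {z₀ : M}
    {f : M → SymSpace h} (hf : f ∈ BasedHarmonic B h z₀) :
    (fun z => cartanEmbedding h (f z)) ∈ ModifiedHarmonic B h z₀ := by
  refine ⟨fun e he => ?_, fun z => (bijOn_cartanEmbedding h).mapsTo (mem_univ _),
    fun z => cartanEmbedding_mul_self hsq _, ?_⟩
  · exact harmonicOn_of_tension_eq_zero B e.open_target (hf.1 e he).smooth.smoothOn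
      fun w hw => tension_eq_zero_of_isQuotHarmonic B hsq hf.1 he hw
  · simp only [hf.2, cartanEmbedding_mk]
    simp

theorem bijOn_basedHarmonic (hG : IsClosed (G : Set Aˣ)) (B : BiinvariantMetric G) {h : G}
    (hsq : h * h = 1) (z₀ : M) :
    BijOn (fun (f : M → SymSpace h) (z : M) => cartanEmbedding h (f z))
      (BasedHarmonic B h z₀) (ModifiedHarmonic B h z₀) := by
  refine ⟨fun f hf => mem_modifiedHarmonic B hsq hf, fun f _ f' _ hff' =>
    funext fun z => cartanEmbedding_injective h (congrFun hff' z), ?_⟩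
  rintro k ⟨hk, hkc, -, hk0⟩
  choose f hf using fun z => (bijOn_cartanEmbedding h).surjOn (hkc z)
  have hfk : (fun z => cartanEmbedding h (f z)) = k := funext fun z => (hf z).2
  refine ⟨f, ⟨fun e he => ?_, ?_⟩, hfk⟩
  -- The preimage `f` was picked pointwise; its smoothness comes from the local lifts, after which
  -- harmonicity descends.
  · have hH : HarmonicOn B (fun w => cartanEmbedding h (f (e.symm w))) e.target := by
      simpa only [(hf _).2] using hk e he
    exact quotHarmonicOn_of_harmonicOn B
      (quotSmoothOn_of_smoothOn hG hsq e.open_target hH.smooth) hH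
  · apply cartanEmbedding_injective h
    rw [(hf z₀).2, hk0, cartanEmbedding_mk]
    simp

/-- A holomorphic map preserves the harmonic map equation for maps into `G / K`. -/
theorem tension_eq_zero_comp [IsManifold (modelWithCornersSelf ℂ ℂ) (⊤ : WithTop ℕ∞) M]
    {N : Type*} [TopologicalSpace N] [ChartedSpace ℂ N]
    [IsManifold (modelWithCornersSelf ℂ ℂ) (⊤ : WithTop ℕ∞) N] (B : BiinvariantMetric G) {h : G}
    (hsq : h * h = 1) {f : M → SymSpace h} (hf : IsQuotHarmonic B f) {p : N → M}
    (hp : MDifferentiable (modelWithCornersSelf ℂ ℂ) (modelWithCornersSelf ℂ ℂ) p)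
    {e : OpenPartialHomeomorph N ℂ} (he : e ∈ atlas ℂ N) {w : ℂ} (hw : w ∈ e.target) :
    tension (fun x => cartanEmbedding h (f (p (e.symm x)))) w = 0 := by
  have hM : IsManifold (modelWithCornersSelf ℂ ℂ) 1 M := IsManifold.of_le (n := ⊤) le_top
  have hN : IsManifold (modelWithCornersSelf ℂ ℂ) 1 N := IsManifold.of_le (n := ⊤) le_top
  set c := chartAt ℂ (p (e.symm w)) with hc
  have hcA : c ∈ atlas ℂ M := chart_mem_atlas ℂ _
  -- The region where `p`, read in the charts `e` and `c`, is a holomorphic map between open subsets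
  -- of `ℂ`.
  set W : Set ℂ := e.target ∩ e.symm ⁻¹' (p ⁻¹' c.source) with hW
  have hWo : IsOpen W :=
    e.symm.isOpen_inter_preimage (c.open_source.preimage hp.continuous)
  have hwW : w ∈ W := ⟨hw, mem_chart_source ℂ (p (e.symm w))⟩
  have hφ : DifferentiableOn ℂ (fun x => c (p (e.symm x))) W := by
    rw [← mdifferentiableOn_iff_differentiableOn]
    have h1 := (mdifferentiableOn_atlas_symm (I := modelWithCornersSelf ℂ ℂ) he).mono
      (inter_subset_left : W ⊆ e.target)
    have h2 := hp.comp_mdifferentiableOn h1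
    exact (mdifferentiableOn_atlas (I := modelWithCornersSelf ℂ ℂ) hcA).comp h2
      fun x hx => hx.2
  have hm : MapsTo (fun x => c (p (e.symm x))) W c.target := fun x hx => c.map_source hx.2
  have e1 := tension_comp (u := fun x => cartanEmbedding h (f (c.symm x))) c.open_target hWo
    (hf c hcA).smooth.smoothOn hφ hm hwW
  rw [tension_eq_zero_of_isQuotHarmonic B hsq hf hcA (hm hwW), smul_zero] at e1
  rw [← e1]
  refine tension_congr hWo (fun x hx => ?_) hwW
  rw [c.left_inv hx.2]

/-- The members of the associated family of a harmonic map are harmonic. -/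
theorem basedHarmonic_of_isExtendedFrame (B : BiinvariantMetric G) {h : G} (hsq : h * h = 1)
    {y₀ : M} {f : M → SymSpace h} {F : Circle → M → G} (hF : IsExtendedFrame h y₀ f F)
    (hf : ∀ e ∈ atlas ℂ M, ∀ w ∈ e.target,
      tension (fun x => cartanEmbedding h (f (e.symm x))) w = 0) (l : Circle) :
    (fun y => (F l y : SymSpace h)) ∈ BasedHarmonic B h y₀ := by
  refine ⟨fun e he => ?_, by simp only [hF.base l]⟩
  have hsm : QuotSmoothOn (fun x => (F l (e.symm x) : SymSpace h)) e.target := fun w hw =>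
    ⟨e.target, e.open_target, hw, fun x => F l (e.symm x), hF.smooth l e he, fun x _ => rfl⟩
  refine quotHarmonicOn_of_harmonicOn B hsm
    (harmonicOn_of_tension_eq_zero B e.open_target hsm.smoothOn fun w hw => ?_)
  have h0 := hf e he w hw
  simp only [hF.lift, cartanEmbedding_mk] at h0 ⊢
  rw [tension_conj hsq e.open_target (hF.smooth 1 e he) hw, smul_eq_zero_iff_right (by norm_num)]
    at h0
  have h1 : covariantDivergence h (fun x => F 1 (e.symm x)) w = 0 := by
    have h2 := congrArg (fun X => mat (F 1 (e.symm w))⁻¹ * X * mat (F 1 (e.symm w))) h0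
    simpa [mul_assoc] using h2
  -- The covariant divergence of `F_λ` is `Re λ` times that of `F_1`, which is zero by `h1`.
  rw [tension_conj hsq e.open_target (hF.smooth l e he) hw,
    covariantDivergence_frame hsq e.open_target (hF.smooth 1 e he) (l : ℂ).re (l : ℂ).im
      (fun x hx v => eq_of_frame_equation (hF.equation l e he x hx v)) hw, h1]
  simp

end surface

end CartanHarmonic

end

theorem mainTheorem12
    {V : Type*} [NormedAddCommGroup V] [NormedSpace ℝ V] [FiniteDimensional ℝ V]
    -- `G` is a connected semisimple linear Lie group with trivial center
    (G : Subgroup (V →L[ℝ] V)ˣ)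
    (hG_closed : IsClosed (G : Set (V →L[ℝ] V)ˣ))
    (hG_connected : IsConnected (G : Set (V →L[ℝ] V)ˣ))
    (hG_semisimple : LieAlgebra.IsSemisimple ℝ (CartanHarmonic.lieAlg G))
    (hG_center : Subgroup.center G = ⊥)
    -- `g ↦ h g h⁻¹` is an involution
    (h : G) (hh : ∀ g : G, MulAut.conj h (MulAut.conj h g) = g)
    (B : CartanHarmonic.BiinvariantMetric G)
    -- `M` is a connected Riemann surface
    {M : Type*} [TopologicalSpace M] [T2Space M] [ConnectedSpace M] [ChartedSpace ℂ M]
    [IsManifold (modelWithCornersSelf ℂ ℂ) (⊤ : WithTop ℕ∞) M] (z₀ : M) :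
    -- the modified Cartan embedding is a bijection of `G / K` onto the conjugacy class of `h`
    Set.BijOn (CartanHarmonic.cartanEmbedding h) Set.univ (CartanHarmonic.conjClass h) ∧
    -- composition with it is the asserted bijection
    Set.BijOn (fun (f : M → CartanHarmonic.SymSpace h) (z : M) =>
        CartanHarmonic.cartanEmbedding h (f z))
      (CartanHarmonic.BasedHarmonic B h z₀) (CartanHarmonic.ModifiedHarmonic B h z₀) ∧
    -- the same for all members of the associated family, on the universal covering `p : N → M`
    ∀ {N : Type*} [TopologicalSpace N] [T2Space N] [SimplyConnectedSpace N] [ChartedSpace ℂ N]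
      [IsManifold (modelWithCornersSelf ℂ ℂ) (⊤ : WithTop ℕ∞) N]
      (p : N → M), IsCoveringMap p →
      MDifferentiable (modelWithCornersSelf ℂ ℂ) (modelWithCornersSelf ℂ ℂ) p →
      ∀ y₀ : N, p y₀ = z₀ →
      ∀ f ∈ CartanHarmonic.BasedHarmonic B h z₀, ∀ F : Circle → N → G,
      CartanHarmonic.IsExtendedFrame h y₀ (fun y => f (p y)) F →
      ∀ l : Circle,
        (fun y => (F l y : CartanHarmonic.SymSpace h)) ∈ CartanHarmonic.BasedHarmonic B h y₀ ∧
        (fun y => F l y * h * (F l y)⁻¹) ∈ CartanHarmonic.ModifiedHarmonic B h y₀ ∧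
        ∀ y, CartanHarmonic.cartanEmbedding h (F l y : CartanHarmonic.SymSpace h) =
          F l y * h * (F l y)⁻¹ := by
  have hsq : h * h = 1 := CartanHarmonic.mul_self_eq_one_of_conj_conj hG_center hh
  refine ⟨CartanHarmonic.bijOn_cartanEmbedding h,
    CartanHarmonic.bijOn_basedHarmonic hG_closed B hsq z₀, ?_⟩
  intro N _ _ _ _ _ p _ hp y₀ _ f hf F hF l
  have hl := CartanHarmonic.basedHarmonic_of_isExtendedFrame B hsq hF
    (fun e he w hw => CartanHarmonic.tension_eq_zero_comp B hsq hf.1 hp he hw) l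
  exact ⟨hl, CartanHarmonic.mem_modifiedHarmonic B hsq hl, fun y => rfl⟩
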